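/- Let $S^1=\mathbb R/\mathbb Z$, oriented, and for $a\neq b$ in $S^1$ let $[a,b]$ and $(a,b)$ be the closed and open arcs from $a$ to $b$ in the positive direction, with length $\ell([a,b])$. A $C^1$-diffeomorphism is here an orientation preserving $C^1$-diffeomorphism of $S^1$; its rotation number is an element of $\mathbb R/\mathbb Z$. Two such diffeomorphisms are $\varepsilon$-$C^1$-close if they are uniformly $\varepsilon$-close on $S^1$ and their derivatives are uniformly $\varepsilon$-close. Let $f$ be a $C^1$-diffeomorphism, $n\ge 2$, and let $\{x,f(x),\dots,f^n(x)\}$ be an orbit segment consisting of $n+1$ distinct points. Its initial basic interval $[a,b]$ and final basic interval $[c,d]$ are the arcs with endpoints in the segment such that $x$ is the only point of the segment in $(a,b)$ and $f^n(x)$ is the only point of the segment in $(c,d)$. Write $c=f^i(x)$, $d=f^j(x)$ with $0\le i,j\le n$. The segment is adapted if $i\ne0$, $j\neq 0$ and $i+j\ne n-1$. Its initial and final ratios are $\frac{\ell([a,x])}{\ell([x,b])}$ and $\frac{\ell([c,f^n(x)])}{\ell([f^n(x),d])}$. Two orbit segments $\{x,\dots,f^n(x)\}$ and $\{y,\dots,g^n(y)\}$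 are similarly ordered if there is an orientation preserving homeomorphism $\varphi$ of $S^1$ with $\varphi(f^m(x))=g^m(y)$ for $0\le m\le n$. **Theorem.** For every $\alpha\in\mathbb R\setminus\mathbb Q$ there is a strictly increasing sequence $(k_i)$ of natural numbers such that, for all $C^1$-diffeomorphisms $f,g$ with rotation number $\alpha$ modulo $\mathbb Z$, all points $x,y\in S^1$ and all $\varepsilon>0$: 1. for every $i$, the orbit segments $\{x,\dots,f^{k_i}(x)\}$ and $\{y,\dots,g^{k_i}(y)\}$ are adapted; 2. there is $i_0$ such that for every $i\ge i_0$ there is a $C^1$-diffeomorphism $g_i$ such that - $g_i$ is $\varepsilon$-$C^1$-close to $g$; - $\{y,\dots,g_i^{k_i}(y)\}$ is an adapted segment of $g_i$, similarly ordered both as $\{x,\dots,f^{k_i}(x)\}$ and as $\{y,\dots,g^{k_i}(y)\}$; - the initial and final ratios of $\{y,\dots,g_i^{k_i}(y)\}$ for $g_i$ are equal to the initial and final ratios, respectively, of $\{x,\dots,f^{k_i}(x)\}$ for $f$. -/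

import Mathlib

/-- `F`, a nondecreasing map of the line with `F (t + 1) = F t + 1`, is a lift of the map `φ` of the
circle `ℝ / ℤ`. -/
def IsLift (F : CircleDeg1Lift) (φ : UnitAddCircle → UnitAddCircle) : Prop :=
  ∀ t : ℝ, φ (t : UnitAddCircle) = ((F t : ℝ) : UnitAddCircle)

/-- A homeomorphism of the circle is orientation preserving if it has a nondecreasing lift of
degree one. -/
def IsOrientationPreserving (φ : UnitAddCircle ≃ₜ UnitAddCircle) : Prop :=
  ∃ F : CircleDeg1Lift, IsLift F φ

/-- `F` is a lift of `φ` which is of class `C¹` with everywhere positive derivative. -/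
structure IsC1Lift (F : CircleDeg1Lift) (φ : UnitAddCircle → UnitAddCircle) : Prop where
  isLift : IsLift F φ
  contDiff : ContDiff ℝ 1 F
  deriv_pos : ∀ t : ℝ, 0 < deriv F t

/-- Two `C¹` lifts of the same map differ by a constant integer. -/
theorem IsC1Lift.exists_int {F G : CircleDeg1Lift} {φ : UnitAddCircle → UnitAddCircle}
    (hF : IsC1Lift F φ) (hG : IsC1Lift G φ) : ∃ m : ℤ, ∀ t : ℝ, F t = m + G t := by
  have h : ∀ t : ℝ, F t - G t ∈ Set.range (Int.cast : ℤ → ℝ) := by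
    intro t
    have h1 : ((F t : ℝ) : UnitAddCircle) = ((G t : ℝ) : UnitAddCircle) := by
      rw [← hF.isLift t, ← hG.isLift t]
    have h2 : ((F t - G t : ℝ) : UnitAddCircle) = 0 := by
      rw [AddCircle.coe_sub, h1, sub_self]
    obtain ⟨m, hm⟩ := (AddCircle.coe_eq_zero_iff (1 : ℝ)).1 h2
    exact ⟨m, by simpa using hm⟩
  have hc : Continuous fun t : ℝ => F t - G t :=
    hF.contDiff.continuous.sub hG.contDiff.continuous
  have hd : IsDiscrete (Set.range (Int.cast : ℤ → ℝ)) :=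
    ⟨Int.isClosedEmbedding_coe_real.isEmbedding.toHomeomorph.symm.isEmbedding.discreteTopology⟩
  obtain ⟨m, hm⟩ := h 0
  refine ⟨m, fun t => ?_⟩
  have h3 := isPreconnected_univ.constant_of_mapsTo hd hc.continuousOn (fun t _ => h t)
    (Set.mem_univ t) (Set.mem_univ 0)
  have h4 : F t - G t = F 0 - G 0 := h3
  linarith

/-- An orientation preserving `C¹` diffeomorphism of the circle `ℝ / ℤ`. (The inverse is
automatically of class `C¹` because the derivative does not vanish.) -/
structure CircleDiffeo where
  toHomeomorph : UnitAddCircle ≃ₜ UnitAddCircle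
  exists_lift : ∃ F : CircleDeg1Lift, IsC1Lift F toHomeomorph

namespace CircleDiffeo

instance : CoeFun CircleDiffeo fun _ => UnitAddCircle → UnitAddCircle :=
  ⟨fun f => f.toHomeomorph⟩

/-- A `C¹` lift of `f`; it is unique up to an integer constant. -/
noncomputable def lift (f : CircleDiffeo) : CircleDeg1Lift :=
  f.exists_lift.choose

theorem isC1Lift_lift (f : CircleDiffeo) : IsC1Lift f.lift f :=
  f.exists_lift.choose_spec

/-- The rotation number of `f`, an element of `ℝ / ℤ`. -/
noncomputable def rotationNumber (f : CircleDiffeo) : UnitAddCircle :=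
  ((f.lift.translationNumber : ℝ) : UnitAddCircle)

/-- The rotation number can be computed with any `C¹` lift. -/
theorem rotationNumber_eq {f : CircleDiffeo} {F : CircleDeg1Lift} (hF : IsC1Lift F f) :
    f.rotationNumber = ((F.translationNumber : ℝ) : UnitAddCircle) := by
  obtain ⟨m, hm⟩ := f.isC1Lift_lift.exists_int hF
  have h1 : f.lift = (CircleDeg1Lift.translate (Multiplicative.ofAdd (m : ℝ)) : CircleDeg1Lift) * F :=
    CircleDeg1Lift.ext fun t => by simp [hm t]
  have h2 : Commute (CircleDeg1Lift.translate (Multiplicative.ofAdd (m : ℝ)) : CircleDeg1Lift) F :=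
    CircleDeg1Lift.ext fun t => by simp
  rw [rotationNumber, h1, CircleDeg1Lift.translationNumber_mul_of_commute h2,
    CircleDeg1Lift.translationNumber_translate, AddCircle.coe_add]
  have h3 : ((m : ℝ) : UnitAddCircle) = 0 :=
    (AddCircle.coe_eq_zero_iff (1 : ℝ)).2 ⟨m, by simp⟩
  rw [h3, zero_add]

/-- The derivative of `f` at the point of the circle represented by the real number `t`. -/
noncomputable def derivAt (f : CircleDiffeo) (t : ℝ) : ℝ :=
  deriv f.lift t

/-- The derivative can be computed with any `C¹` lift. -/
theorem derivAt_eq {f : CircleDiffeo} {F : CircleDeg1Lift} (hF : IsC1Lift F f) (t : ℝ) :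
    f.derivAt t = deriv F t := by
  obtain ⟨m, hm⟩ := f.isC1Lift_lift.exists_int hF
  have h1 : (f.lift : ℝ → ℝ) = fun s => (m : ℝ) + F s := funext hm
  rw [derivAt, h1, deriv_const_add]

/-- `f` and `g` are `ε`-`C¹`-close: they are uniformly `ε`-close, and so are their derivatives.
(By compactness the strict pointwise inequalities say that both suprema are less than `ε`.) -/
def C1Close (ε : ℝ) (f g : CircleDiffeo) : Prop :=
  (∀ z : UnitAddCircle, dist (f z) (g z) < ε) ∧ ∀ t : ℝ, |f.derivAt t - g.derivAt t| < ε

end CircleDiffeo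

/-- The length, in `[0, 1)`, of the arc `[a, b]` of the circle going from `a` to `b` in the positive
direction. -/
noncomputable def arcLength (a b : UnitAddCircle) : ℝ :=
  (AddCircle.equivIco 1 0 (b - a) : ℝ)

/-- The orbit segment `{x, f x, …, fⁿ x}`, as a set. -/
def orbitSegment (f : CircleDiffeo) (x : UnitAddCircle) (n : ℕ) : Set UnitAddCircle :=
  {z | ∃ m ≤ n, f^[m] x = z}

/-- `[a, b]` is the basic interval around the point `p` of the orbit segment `{x, …, fⁿ x}`: its end
points belong to the segment, and `p` is the only point of the segment in the open arc `(a, b)`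
that goes from `a` to `b` in the positive direction. The initial basic interval is the one around
`p = x`, the final basic interval the one around `p = fⁿ x`. -/
structure IsBasicInterval (f : CircleDiffeo) (x : UnitAddCircle) (n : ℕ)
    (p a b : UnitAddCircle) : Prop where
  left_mem : a ∈ orbitSegment f x n
  right_mem : b ∈ orbitSegment f x n
  inter_eq : Set.cIoo a b ∩ orbitSegment f x n = {p}

/-- The orbit segment `{x, …, fⁿ x}`, where `n ≥ 2` and the `n + 1` points are distinct, is adapted:
writing its final basic interval as `[fⁱ x, fʲ x]`, one has `i ≠ 0`, `j ≠ 0` and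
`i + j ≠ n - 1`. -/
def IsAdapted (f : CircleDiffeo) (x : UnitAddCircle) (n : ℕ) : Prop :=
  2 ≤ n ∧ Set.InjOn (fun m => f^[m] x) (Set.Iic n) ∧
    ∃ i ≤ n, ∃ j ≤ n, IsBasicInterval f x n (f^[n] x) (f^[i] x) (f^[j] x) ∧
      i ≠ 0 ∧ j ≠ 0 ∧ i + j + 1 ≠ n

/-- `ρ` is the initial ratio `ℓ([a, x]) / ℓ([x, b])` of the orbit segment `{x, …, fⁿ x}`, where
`[a, b]` is its initial basic interval. -/
def HasInitialRatio (f : CircleDiffeo) (x : UnitAddCircle) (n : ℕ) (ρ : ℝ) : Prop :=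
  ∃ a b, IsBasicInterval f x n x a b ∧ ρ = arcLength a x / arcLength x b

/-- `ρ` is the final ratio `ℓ([c, fⁿ x]) / ℓ([fⁿ x, d])` of the orbit segment `{x, …, fⁿ x}`, where
`[c, d]` is its final basic interval. -/
def HasFinalRatio (f : CircleDiffeo) (x : UnitAddCircle) (n : ℕ) (ρ : ℝ) : Prop :=
  ∃ c d, IsBasicInterval f x n (f^[n] x) c d ∧
    ρ = arcLength c (f^[n] x) / arcLength (f^[n] x) d

/-- The orbit segments `x, f x, …, fⁿ x` and `y, g y, …, gⁿ y` are similarly ordered: an orientation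
preserving homeomorphism of the circle maps each point of the first to the corresponding point of
the second. -/
def SimilarlyOrdered (f : CircleDiffeo) (x : UnitAddCircle) (g : CircleDiffeo) (y : UnitAddCircle)
    (n : ℕ) : Prop :=
  ∃ φ : UnitAddCircle ≃ₜ UnitAddCircle, IsOrientationPreserving φ ∧
    ∀ m ≤ n, φ (f^[m] x) = g^[m] y

/-! A single perturbation serves for all large `i`: a conjugate `H = Φ F Φ⁻¹` of a lift `F` of `f`,
`C¹`-close to `g`. It has rotation number `α`, so its orbits are ordered like those of the rotation;
this gives adaptedness and similar ordering. The ratios agree because `Φ` sends `x` to `y` and is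
affine on both basic intervals.

The times `k i` satisfy `k i * α → 1/2` modulo `1`, so the final basic intervals gather half a turn
away from `x` and the initial ones at `x`: it suffices that `Φ` be affine near two fixed places.
Nearness is measured through the semiconjugacy `π` of `F` to the rotation, because `f` may have
wandering intervals and basic intervals need not shrink in length. The same times give adapted
segments (`exists_half_neighbours`).

The conjugacy `Φ = ψ ∘ P` passes through the rotation. If `P' = exp v / Z`, the conjugate of `F` by
`P` has derivative `exp (log F' + v ∘ F - v)`, so `P` comes from an approximate solution of the
cohomological equation. The Birkhoff sums of `log F'` grow sublinearly
(`exists_abs_logDerivSum_le`), hence their averages are such solutions;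
`exists_vanishing_abs_log_deriv_add_sub_le` makes `v` vanish at the two places.

For `ψ`, the lift `G` of `g` is perturbed to have a Lipschitz derivative and the same translation
number. Denjoy's theorem then gives a topological conjugacy to the rotation. Its running averages
are diffeomorphisms whose derivative ratios are difference quotients of the perturbed map, so they
nearly conjugate in the `C¹` sense (`exists_approx_conj`). Finally `exists_close_locally_affine`
flattens the derivative near the half-integers. -/

/-! ### Arithmetic of an irrational rotation -/

namespace Irrational

variable {α : ℝ}

theorem nat_mul_sub_int_ne_zero (hα : Irrational α) {m : ℕ} (hm : 0 < m) (l : ℤ) :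
    (m : ℝ) * α - l ≠ 0 := by
  have h : Irrational ((m : ℝ) * α) := hα.natCast_mul hm.ne'
  exact sub_ne_zero.2 (h.ne_int l)

theorem nat_mul_add_int_inj (hα : Irrational α) {m m' : ℕ} {l l' : ℤ}
    (h : (m : ℝ) * α + l = m' * α + l') : m = m' ∧ l = l' := by
  have hm : m = m' := by
    by_contra hne
    rcases lt_or_gt_of_ne hne with hlt | hlt
    · refine hα.nat_mul_sub_int_ne_zero (m := m' - m) (by omega) (l - l') ?_
      push_cast [Nat.cast_sub hlt.le]; linarith
    · refine hα.nat_mul_sub_int_ne_zero (m := m - m') (by omega) (l' - l) ?_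
      push_cast [Nat.cast_sub hlt.le]; linarith
  subst hm
  exact ⟨rfl, by exact_mod_cast add_left_cancel h⟩

/-- The first multiples of an irrational number stay away from the integers. -/
theorem exists_lt_abs_nat_mul_sub_int (hα : Irrational α) (M : ℕ) :
    ∃ β > 0, ∀ m : ℕ, 0 < m → m ≤ M → ∀ l : ℤ, β < |(m : ℝ) * α - l| := by
  induction M with
  | zero => exact ⟨1, one_pos, fun m h1 h2 => by omega⟩
  | succ M ih =>
    obtain ⟨β, hβ, h⟩ := ih
    have hr : (0 : ℝ) < |((M + 1 : ℕ) : ℝ) * α - round (((M + 1 : ℕ) : ℝ) * α)| :=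
      abs_pos.2 (hα.nat_mul_sub_int_ne_zero (Nat.succ_pos M) _)
    refine ⟨min β (|((M + 1 : ℕ) : ℝ) * α - round (((M + 1 : ℕ) : ℝ) * α)| / 2),
      lt_min hβ (half_pos hr), fun m hm hmM l => ?_⟩
    rcases Nat.lt_or_ge M m with hlt | hge
    · obtain rfl : m = M + 1 := by omega
      exact (min_le_right _ _).trans_lt ((half_lt_self hr).trans_le (round_le _ l))
    · exact (min_le_left _ _).trans_lt (h m hm hge l)

/-- Every interval of length `κ` contains, modulo `1`, one of the first `N` multiples of `α`. -/
theorem exists_nat_mul_add_int_mem_Ioo (hα : Irrational α) {κ : ℝ} (hκ : 0 < κ) :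
    ∃ N : ℕ, ∀ θ : ℝ, ∃ m < N, ∃ l : ℤ, θ < (m : ℝ) * α + l ∧ (m : ℝ) * α + l < θ + κ := by
  obtain ⟨n, hn⟩ := exists_nat_one_div_lt (half_pos hκ)
  obtain ⟨p, q, hq, -, hpq⟩ := Real.exists_int_int_abs_mul_sub_le α (Nat.succ_pos n)
  lift q to ℕ using hq.le
  have hq' : 0 < q := by exact_mod_cast hq
  -- By Dirichlet, `q` steps move by `|δ| < κ / 2`, so the multiples of `|δ|` that cover one unit
  -- visit every interval of length `κ`.
  set δ : ℝ := (q : ℝ) * α - p with hδ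
  have hδ0 : δ ≠ 0 := hα.nat_mul_sub_int_ne_zero hq' p
  have hδκ : |δ| < κ / 2 := by
    refine lt_of_le_of_lt ?_ hn
    have h1 : |δ| ≤ 1 / ((n.succ : ℝ) + 1) := by simpa [hδ, mul_comm] using hpq
    refine h1.trans ?_
    apply one_div_le_one_div_of_le <;> push_cast <;> first | positivity | linarith
  have hpos : 0 < |δ| := abs_pos.2 hδ0
  obtain ⟨J, hJ⟩ := exists_nat_gt (1 / |δ|)
  have key : ∀ w : ℝ, ∃ j : ℕ, j < J + 2 ∧ w < j * |δ| + ⌊w⌋ ∧ j * |δ| + ⌊w⌋ < w + κ := by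
    intro w
    have hf0 := Int.fract_nonneg w
    have hf1 := Int.fract_lt_one w
    have hw := Int.floor_add_fract w
    refine ⟨⌊Int.fract w / |δ|⌋₊ + 1, ?_, ?_, ?_⟩
    · have h1 : Int.fract w / |δ| < J :=
        lt_of_le_of_lt (div_le_div_of_nonneg_right hf1.le hpos.le) hJ
      have h2 : ⌊Int.fract w / |δ|⌋₊ < J := (Nat.floor_lt (by positivity)).2 h1
      omega
    · have h1 := Nat.lt_floor_add_one (Int.fract w / |δ|)
      rw [div_lt_iff₀ hpos] at h1
      push_cast
      linarith
    · have h1 := Nat.floor_le (a := Int.fract w / |δ|) (by positivity)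
      rw [le_div_iff₀ hpos] at h1
      push_cast
      nlinarith
  have hbound : ∀ j : ℕ, j < J + 2 → j * q < (J + 2) * q := fun j hj =>
    Nat.mul_lt_mul_of_pos_right hj hq'
  refine ⟨(J + 2) * q, fun θ => ?_⟩
  rcases lt_or_gt_of_ne hδ0 with hneg | hp
  -- A negative step is treated by reflecting the target interval.
  · obtain ⟨j, hj, h1, h2⟩ := key (-(θ + κ))
    rw [abs_of_neg hneg, hδ] at h1 h2
    refine ⟨j * q, hbound j hj, -(j * p) - ⌊-(θ + κ)⌋, ?_, ?_⟩ <;> push_cast <;> linarith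
  · obtain ⟨j, hj, h1, h2⟩ := key θ
    rw [abs_of_pos hp, hδ] at h1 h2
    refine ⟨j * q, hbound j hj, -(j * p) + ⌊θ⌋, ?_, ?_⟩ <;> push_cast <;> linarith

/-- The two neighbours of `kα` modulo `1` among `0, α, …, nα`. -/
theorem exists_rotation_neighbours (hα : Irrational α) {n k : ℕ} (hn : 2 ≤ n) (hk : k ≤ n) :
    ∃ i : ℕ, i ≤ n ∧ ∃ j : ℕ, j ≤ n ∧ ∃ a b : ℤ, (i : ℝ) * α + a < k * α ∧ (k : ℝ) * α < j * α + b ∧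
      (j : ℝ) * α + b < i * α + a + 1 ∧
      ∀ m : ℕ, m ≤ n → ∀ l : ℤ, (i : ℝ) * α + a < m * α + l → (m : ℝ) * α + l < j * α + b →
        m = k ∧ l = 0 := by
  set s : Finset ℕ := (Finset.range (n + 1)).erase k with hs
  -- `p m` represents `mα` in `(kα - 1, kα]`: the largest value is the left neighbour, the smallest
  -- one plus `1` the right neighbour.
  set c : ℕ → ℤ := fun m => ⌊(k : ℝ) * α - m * α⌋ with hc
  set p : ℕ → ℝ := fun m => (m : ℝ) * α + c m with hp
  have hmem : ∀ m, m ∈ s ↔ m ≠ k ∧ m ≤ n := by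
    intro m; simp [hs]
  have hlt : ∀ m ∈ s, p m < k * α := by
    intro m hm
    have h1 := Int.floor_le ((k : ℝ) * α - m * α)
    refine lt_of_le_of_ne (by simp only [hp, hc]; linarith) fun h => ?_
    have h2 : (m : ℝ) * α + c m = k * α + (0 : ℤ) := by simpa [hp] using h
    exact ((hmem m).1 hm).1 (hα.nat_mul_add_int_inj h2).1
  have hgt : ∀ m, (k : ℝ) * α < p m + 1 := by
    intro m
    have h1 := Int.lt_floor_add_one ((k : ℝ) * α - m * α)
    simp only [hp, hc]; linarith
  have hinj : ∀ m m', p m = p m' → m = m' := fun m m' h => (hα.nat_mul_add_int_inj h).1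
  have hcard : 2 ≤ s.card := by
    rw [hs, Finset.card_erase_of_mem (Finset.mem_range.2 (by omega)), Finset.card_range]; omega
  have hne : s.Nonempty := Finset.card_pos.1 (by omega)
  obtain ⟨i, hi, himax⟩ := s.exists_max_image p hne
  obtain ⟨j, hj, hjmin⟩ := s.exists_min_image p hne
  -- As `n ≥ 2`, some point other than `i` remains, so the neighbours differ and span less than a
  -- full turn.
  obtain ⟨m, hm, hmi⟩ := Finset.exists_mem_ne (by omega : 1 < s.card) i
  have h1 : p j < p i := by
    refine (hjmin m hm).trans_lt (lt_of_le_of_ne (himax m hm) fun h => hmi (hinj _ _ h))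
  refine ⟨i, ((hmem i).1 hi).2, j, ((hmem j).1 hj).2, c i, c j + 1, hlt i hi, ?_, ?_, ?_⟩
  · have := hgt j; simp only [hp] at this; push_cast; linarith
  · simp only [hp] at h1; push_cast; linarith
  · intro m hm l hl1 hl2
    have hi' := hlt i hi
    have hgi := hgt i
    have hj' := hlt j hj
    have e1 : (i : ℝ) * α + c i = p i := rfl
    have e2 : (j : ℝ) * α + (c j + 1 : ℤ) = p j + 1 := by simp only [hp]; push_cast; ring
    rw [e1] at hl1
    rw [e2] at hl2
    by_cases hmk : m = k
    · subst hmk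
      refine ⟨rfl, ?_⟩
      have h3 : (-1 : ℝ) < l := by linarith
      have h4 : (l : ℝ) < 1 := by linarith
      have h5 : (-1 : ℤ) < l := by exact_mod_cast h3
      have h6 : l < 1 := by exact_mod_cast h4
      omega
    · exfalso
      have hms : m ∈ s := (hmem m).2 ⟨hmk, hm⟩
      have hm1 := himax m hms
      have hm2 := hjmin m hms
      rcases le_or_gt l (c m) with h | h
      · have h' : (l : ℝ) ≤ c m := by exact_mod_cast h
        simp only [hp] at hm1 hl1; linarith
      · have h' : (c m : ℝ) + 1 ≤ l := by exact_mod_cast h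
        simp only [hp] at hm2 hl2; linarith

/-- The two neighbours of `kα` modulo `1` among `0, α, …, nα` are close to `kα` if `n` is large. -/
theorem exists_rotation_neighbours_lt (hα : Irrational α) {κ : ℝ} (hκ : 0 < κ) :
    ∃ N : ℕ, ∀ n : ℕ, N ≤ n → ∀ k : ℕ, k ≤ n →
    ∃ i : ℕ, i ≤ n ∧ ∃ j : ℕ, j ≤ n ∧ ∃ a b : ℤ, (i : ℝ) * α + a < k * α ∧ (k : ℝ) * α < j * α + b ∧
      (j : ℝ) * α + b < i * α + a + 1 ∧
      (∀ m : ℕ, m ≤ n → ∀ l : ℤ, (i : ℝ) * α + a < m * α + l → (m : ℝ) * α + l < j * α + b →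
        m = k ∧ l = 0) ∧ k * α - κ < (i : ℝ) * α + a ∧ (j : ℝ) * α + b < k * α + κ := by
  obtain ⟨N, hN⟩ := hα.exists_nat_mul_add_int_mem_Ioo hκ
  refine ⟨max N 2, fun n hn k hk => ?_⟩
  have hn1 : N ≤ n := (le_max_left _ _).trans hn
  obtain ⟨i, hi, j, hj, a, b, h1, h2, h3, h4⟩ :=
    hα.exists_rotation_neighbours ((le_max_right _ _).trans hn) hk
  refine ⟨i, hi, j, hj, a, b, h1, h2, h3, h4, ?_, ?_⟩
  · obtain ⟨m, hm, l, hl1, hl2⟩ := hN (k * α - κ)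
    by_contra! hle
    obtain ⟨rfl, rfl⟩ := h4 m (by omega) l (by linarith) (by linarith)
    simp at hl2
  · obtain ⟨m, hm, l, hl1, hl2⟩ := hN (k * α)
    by_contra! hle
    obtain ⟨rfl, rfl⟩ := h4 m (by omega) l (by linarith) (by linarith)
    simp at hl1

/-- For `kα` close to `1/2` modulo `1`, the neighbours of `nα` among `0, …, nα` satisfy the
conditions defining adapted segments. -/
theorem exists_half_neighbours (hα : Irrational α) :
    ∃ κ : ℝ, 0 < κ ∧ ∃ N : ℕ, 2 ≤ N ∧ ∀ n : ℕ, N ≤ n → ∀ c : ℤ, |(n : ℝ) * α - 1 / 2 - c| < κ →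
    ∃ i : ℕ, i ≤ n ∧ ∃ j : ℕ, j ≤ n ∧ ∃ a b : ℤ, (i : ℝ) * α + a < n * α ∧ (n : ℝ) * α < j * α + b ∧
      (j : ℝ) * α + b < i * α + a + 1 ∧
      (∀ m : ℕ, m ≤ n → ∀ l : ℤ, (i : ℝ) * α + a < m * α + l → (m : ℝ) * α + l < j * α + b →
        m = n ∧ l = 0) ∧ i ≠ 0 ∧ j ≠ 0 ∧ i + j + 1 ≠ n := by
  have h2 : Irrational (2 * α) := by simpa using hα.natCast_mul (m := 2) (by norm_num)
  obtain ⟨β, hβ, hβ2⟩ := h2.exists_lt_abs_nat_mul_sub_int 1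
  have hβ' : ∀ l : ℤ, β < |2 * α - l| := by simpa using hβ2 1
  -- `1 / 10` separates `0` from the neighbours of a point near `1/2`; `β / 10` beats the error `6κ`
  -- of the last case.
  have hκ : 0 < min (β / 10) (1 / 10) := by positivity
  obtain ⟨N, hN⟩ := hα.exists_rotation_neighbours_lt hκ
  refine ⟨_, hκ, max N 2, le_max_right _ _, fun n hn c hc => ?_⟩
  obtain ⟨i, hi, j, hj, a, b, h1, h2, h3, h4, h5, h6⟩ :=
    hN n ((le_max_left _ _).trans hn) n le_rfl
  set κ := min (β / 10) (1 / 10)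
  have hκ1 : κ ≤ β / 10 := min_le_left _ _
  have hκ2 : κ ≤ 1 / 10 := min_le_right _ _
  obtain ⟨hc1, hc2⟩ := abs_lt.1 hc
  have hfar : ∀ l : ℤ, κ ≤ |(n : ℝ) * α - l| := by
    intro l
    by_contra! h
    obtain ⟨h7, h8⟩ := abs_lt.1 h
    have h9 : (c : ℝ) - l < 0 := by linarith
    have h10 : (-1 : ℝ) < c - l := by linarith
    have h9' : c - l < 0 := by exact_mod_cast h9
    have h10' : -1 < c - l := by exact_mod_cast h10
    omega
  refine ⟨i, hi, j, hj, a, b, h1, h2, h3, h4, ?_, ?_, ?_⟩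
  · rintro rfl
    have h7 := hfar a
    rw [abs_of_pos (by simpa using h1)] at h7
    simp at h5
    linarith
  · rintro rfl
    have h7 := hfar b
    rw [abs_of_neg (by simpa using h2)] at h7
    simp at h6
    linarith
  · intro hij
    have e : (n : ℝ) = i + j + 1 := by exact_mod_cast hij.symm
    -- Both neighbours are near `nα`, so `i + j + 1 = n` gives `2nα ≈ nα - α`, hence `α ≈ -nα ≈ 1/2`
    -- modulo `1`, and `2α` would be too close to an integer.
    have h7 := hβ' (2 * (a + b) - 1 - 2 * c)
    refine absurd h7 (not_lt.2 ?_)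
    push_cast
    have e' : (n : ℝ) * α = i * α + j * α + α := by rw [e]; ring
    rw [abs_le]
    constructor <;> linarith

/-- There are arbitrarily large multiples of `α` as close to `1/2` modulo `1` as desired. -/
theorem exists_strictMono_nat_mul_near_half (hα : Irrational α) {κ : ℝ} (hκ : 0 < κ) (N : ℕ) :
    ∃ k : ℕ → ℕ, StrictMono k ∧ ∀ i, N ≤ k i ∧
      ∃ c : ℤ, |(k i : ℝ) * α - 1 / 2 - c| < min κ (1 / ((i : ℝ) + 1)) := by
  have h := Filter.extraction_forall_of_frequently
    (P := fun i n => N ≤ n ∧ ∃ c : ℤ, |(n : ℝ) * α - 1 / 2 - c| < min κ (1 / ((i : ℝ) + 1))) ?_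
  · exact h
  · intro i
    rw [Filter.frequently_atTop]
    intro L
    have hκ' : 0 < min κ (1 / ((i : ℝ) + 1)) := lt_min hκ (by positivity)
    obtain ⟨M, hM⟩ := hα.exists_nat_mul_add_int_mem_Ioo hκ'
    obtain ⟨m, -, l, h1, h2⟩ := hM (1 / 2 - ((max N L : ℕ) : ℝ) * α)
    refine ⟨max N L + m, (le_max_right N L).trans (Nat.le_add_right _ _),
      (le_max_left N L).trans (Nat.le_add_right _ _), -l, ?_⟩
    rw [abs_lt]
    constructor <;> push_cast at * <;> linarith

end Irrational

/-! ### Lifts of circle diffeomorphisms -/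

/-- Intervals that are disjoint modulo `1` have total length at most `1`. -/
theorem sum_length_le_one_of_disjoint_mod_one {ι : Type*} (s : Finset ι) (A B : ι → ℝ)
    (hAB : ∀ i ∈ s, A i < B i)
    (hd : ∀ i ∈ s, ∀ j ∈ s, ∀ (l : ℤ) (u : ℝ), A i ≤ u → u < B i → A j ≤ u + l → u + l < B j →
      i = j ∧ l = 0) :
    ∑ i ∈ s, (B i - A i) ≤ 1 := by
  rcases s.eq_empty_or_nonempty with rfl | ⟨i₀, hi₀⟩
  · simp
  -- These translations bring all left end points into one period starting at `A i₀`. An interval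
  -- sticking out on the right would meet a translate of the interval `i₀`, so Lebesgue measure of
  -- the period bounds the sum.
  set l : ι → ℤ := fun i => -⌊A i - A i₀⌋ with hl
  have h1 : ∀ i, A i₀ ≤ A i + l i := fun i => by
    have := Int.floor_le (A i - A i₀)
    simp only [hl]; push_cast; linarith
  have h2 : ∀ i, A i + l i < A i₀ + 1 := fun i => by
    have := Int.lt_floor_add_one (A i - A i₀)
    simp only [hl]; push_cast; linarith
  have h3 : ∀ i ∈ s, B i + l i ≤ A i₀ + 1 := by
    intro i hi
    by_contra! hlt
    obtain ⟨rfl, h0⟩ := hd i₀ hi₀ i hi (1 - l i) (A i₀) le_rfl (hAB i₀ hi₀)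
      (by push_cast; linarith [h2 i]) (by push_cast; linarith)
    have : l i₀ = 0 := by simp [hl]
    omega
  have hsub : (⋃ i ∈ s, Set.Ico (A i + l i) (B i + l i)) ⊆ Set.Ico (A i₀) (A i₀ + 1) := by
    refine Set.iUnion₂_subset fun i hi => Set.Ico_subset_Ico (h1 i) (h3 i hi)
  have hdis : (s : Set ι).PairwiseDisjoint fun i => Set.Ico (A i + l i) (B i + l i) := by
    intro i hi j hj hij
    refine Set.disjoint_left.2 fun u hu hu' => hij ?_
    refine (hd i hi j hj (l i - l j) (u - l i) ?_ ?_ ?_ ?_).1 <;> push_cast <;>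
      linarith [hu.1, hu.2, hu'.1, hu'.2]
  have hm := MeasureTheory.measure_mono (μ := MeasureTheory.volume) hsub
  rw [MeasureTheory.measure_biUnion_finset hdis fun i _ => measurableSet_Ico] at hm
  simp only [Real.volume_Ico, add_sub_add_right_eq_sub, add_sub_cancel_left] at hm
  rw [← ENNReal.ofReal_sum_of_nonneg fun i hi => (sub_pos.2 (hAB i hi)).le] at hm
  exact (ENNReal.ofReal_le_ofReal_iff zero_le_one).1 hm

namespace CircleDeg1Lift

/-- `F` is of class `C¹` with everywhere positive derivative. -/
structure IsC1Diffeo (F : CircleDeg1Lift) : Prop where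
  contDiff : ContDiff ℝ 1 F
  deriv_pos : ∀ t : ℝ, 0 < deriv F t

namespace IsC1Diffeo

variable {F G : CircleDeg1Lift}

theorem continuous (hF : F.IsC1Diffeo) : Continuous F := hF.contDiff.continuous

theorem differentiable (hF : F.IsC1Diffeo) : Differentiable ℝ F :=
  hF.contDiff.differentiable one_ne_zero

theorem hasDerivAt (hF : F.IsC1Diffeo) (t : ℝ) : HasDerivAt F (deriv F t) t :=
  (hF.differentiable t).hasDerivAt

theorem continuous_deriv (hF : F.IsC1Diffeo) : Continuous (deriv F) :=
  hF.contDiff.continuous_deriv le_rfl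

theorem strictMono (hF : F.IsC1Diffeo) : StrictMono F := strictMono_of_deriv_pos hF.deriv_pos

theorem surjective (hF : F.IsC1Diffeo) : Function.Surjective F :=
  F.continuous_iff_surjective.1 hF.continuous

theorem bijective (hF : F.IsC1Diffeo) : Function.Bijective F :=
  ⟨hF.strictMono.injective, hF.surjective⟩

theorem isUnit (hF : F.IsC1Diffeo) : IsUnit F := isUnit_iff_bijective.2 hF.bijective

theorem of_hasDerivAt {F' : ℝ → ℝ} (h : ∀ t, HasDerivAt F (F' t) t) (hc : Continuous F')
    (hpos : ∀ t, 0 < F' t) : F.IsC1Diffeo := by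
  have hd : deriv F = F' := funext fun t => (h t).deriv
  refine ⟨contDiff_one_iff_deriv.2 ⟨fun t => (h t).differentiableAt, hd ▸ hc⟩, fun t => ?_⟩
  rw [hd]; exact hpos t

theorem mul (hF : F.IsC1Diffeo) (hG : G.IsC1Diffeo) : (F * G).IsC1Diffeo := by
  refine of_hasDerivAt (F' := fun t => deriv F (G t) * deriv G t)
    (fun t => (hF.hasDerivAt (G t)).comp t (hG.hasDerivAt t)) ?_
    fun t => mul_pos (hF.deriv_pos _) (hG.deriv_pos _)
  exact (hF.continuous_deriv.comp hG.continuous).mul hG.continuous_deriv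

theorem inv {E : CircleDeg1Liftˣ} (hE : IsC1Diffeo (E : CircleDeg1Lift)) :
    IsC1Diffeo ((E⁻¹ : CircleDeg1Liftˣ) : CircleDeg1Lift) := by
  have hc : Continuous ((E⁻¹ : CircleDeg1Liftˣ) : CircleDeg1Lift) :=
    (toOrderIso E).symm.continuous
  refine of_hasDerivAt (F' := fun t => (deriv E ((E⁻¹ : CircleDeg1Liftˣ) t))⁻¹)
    (fun t => ?_) ?_ fun t => inv_pos.2 (hE.deriv_pos _)
  · exact (hE.hasDerivAt _).of_local_left_inverse hc.continuousAt (hE.deriv_pos _).ne'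
      (Filter.Eventually.of_forall fun y => units_apply_inv_apply E y)
  · exact (hE.continuous_deriv.comp hc).inv₀ fun t => (hE.deriv_pos _).ne'

theorem deriv_add_one (F : CircleDeg1Lift) (t : ℝ) : deriv F (t + 1) = deriv F t := by
  have h : (fun s => F (s + 1)) = fun s => F s + 1 := funext F.map_add_one
  have h2 := congrFun (congrArg deriv h) t
  rwa [deriv_comp_add_const, deriv_add_const] at h2

end IsC1Diffeo

/-- `π` is a continuous semiconjugacy from `F` to the translation by `α`. -/
structure IsRotationSemiconj (α : ℝ) (F π : CircleDeg1Lift) : Prop where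
  continuous : Continuous π
  map : ∀ t : ℝ, π (F t) = π t + α

/-- Poincaré's semiconjugacy. Its range contains the dense set of all `π 0 + mα + l`, and a monotone
map with dense range is continuous. It need not be injective. -/
theorem IsC1Diffeo.exists_isRotationSemiconj {F : CircleDeg1Lift} (hF : F.IsC1Diffeo)
    (hα : Irrational F.translationNumber) :
    ∃ π : CircleDeg1Lift, IsRotationSemiconj F.translationNumber F π := by
  set α := F.translationNumber with hα'
  have hu : IsUnit ((translate (Multiplicative.ofAdd α) : CircleDeg1Liftˣ) : CircleDeg1Lift) :=
    Units.isUnit _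
  obtain ⟨π, hπ⟩ := semiconj_of_isUnit_of_translationNumber_eq hF.isUnit hu
    (by rw [translationNumber_translate])
  have hmap : ∀ t, π (F t) = π t + α := fun t => by
    have := hπ t
    rw [translate_apply] at this
    rw [this, add_comm]
  have hiter : ∀ (m : ℕ) t, π (F^[m] t) = π t + m * α := by
    intro m
    induction m with
    | zero => simp
    | succ m ih => intro t; rw [Function.iterate_succ_apply', hmap, ih]; push_cast; ring
  refine ⟨π, π.monotone.continuous_of_denseRange ?_, hmap⟩
  rw [DenseRange, dense_iff_exists_between]
  intro a b hab
  obtain ⟨N, hN⟩ := hα.exists_nat_mul_add_int_mem_Ioo (sub_pos.2 hab)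
  obtain ⟨m, -, l, h1, h2⟩ := hN (a - π 0)
  refine ⟨π (F^[m] 0 + l), ⟨_, rfl⟩, ?_, ?_⟩ <;> rw [map_add_int, hiter] <;> linarith

namespace IsRotationSemiconj

variable {α : ℝ} {F π : CircleDeg1Lift}

theorem map_iterate (h : IsRotationSemiconj α F π) (m : ℕ) (t : ℝ) :
    π (F^[m] t) = π t + m * α := by
  induction m with
  | zero => simp
  | succ m ih => rw [Function.iterate_succ_apply', h.map, ih]; push_cast; ring

/-- The orbits of `F` are ordered like those of the rotation. -/
theorem iterate_add_lt (h : IsRotationSemiconj α F π) {m m' : ℕ} {l l' : ℤ}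
    (hlt : (m : ℝ) * α + l < m' * α + l') (t : ℝ) : F^[m] t + l < F^[m'] t + l' := by
  refine π.monotone.reflect_lt ?_
  rw [map_add_int, map_add_int, h.map_iterate, h.map_iterate]
  linarith

theorem lt_iterate_add (h : IsRotationSemiconj α F π) {s t : ℝ} {m : ℕ} {l : ℤ}
    (hlt : π s < π t + (m * α + l)) : s < F^[m] t + l := by
  refine π.monotone.reflect_lt ?_
  rw [map_add_int, h.map_iterate]
  linarith

theorem iterate_add_lt' (h : IsRotationSemiconj α F π) {s t : ℝ} {m : ℕ} {l : ℤ}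
    (hlt : π t + (m * α + l) < π s) : F^[m] t + l < s := by
  refine π.monotone.reflect_lt ?_
  rw [map_add_int, h.map_iterate]
  linarith

end IsRotationSemiconj

theorem abs_sub_sub_le_one (π : CircleDeg1Lift) (s t : ℝ) :
    |(π s - π t) - (s - t)| ≤ 1 := by
  have h1 := Int.floor_le (s - t)
  have h2 := Int.lt_floor_add_one (s - t)
  have h3 : π t + ⌊s - t⌋ ≤ π s := by
    rw [← map_add_int]; exact π.monotone (by linarith)
  have h4 : π s ≤ π t + (⌊s - t⌋ + 1 : ℤ) := by
    rw [← map_add_int]; exact π.monotone (by push_cast; linarith)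
  push_cast at h4
  rw [abs_le]
  constructor <;> linarith

end CircleDeg1Lift

/-! ### Birkhoff sums of the logarithmic derivative -/

namespace Function.Periodic

theorem uniformContinuous_of_continuous {f : ℝ → ℝ} (hp : Function.Periodic f 1)
    (hc : Continuous f) : UniformContinuous f := by
  have h1 : Continuous (hp.lift : AddCircle (1 : ℝ) → ℝ) := hc.quotient_lift _
  have h2 : UniformContinuous ((↑) : ℝ → AddCircle (1 : ℝ)) :=
    uniformContinuous_addMonoidHom_of_continuous (f := QuotientAddGroup.mk' _)
      continuous_quotient_mk'
  exact (CompactSpace.uniformContinuous_of_continuous h1).comp h2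

theorem exists_abs_sub_lt {f : ℝ → ℝ} (hp : Function.Periodic f 1) (hc : Continuous f)
    {ε : ℝ} (hε : 0 < ε) : ∃ η > 0, ∀ a b, |a - b| < η → |f a - f b| < ε :=
  let ⟨η, hη, h⟩ := Metric.uniformContinuous_iff.1 (hp.uniformContinuous_of_continuous hc) ε hε
  ⟨η, hη, fun a b => h (a := a) (b := b)⟩

theorem exists_abs_le {f : ℝ → ℝ} (hp : Function.Periodic f 1) (hc : Continuous f) :
    ∃ C > 0, ∀ t, |f t| ≤ C := by
  obtain ⟨C, hC⟩ := isBounded_iff_forall_norm_le.1 (hp.isBounded_of_continuous one_ne_zero hc)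
  exact ⟨max C 1, by positivity, fun t => (hC _ ⟨t, rfl⟩).trans (le_max_left _ _)⟩

theorem exists_pos_le {f : ℝ → ℝ} (hp : Function.Periodic f 1) (hc : Continuous f)
    (hf : ∀ t, 0 < f t) : ∃ c > 0, ∀ t, c ≤ f t := by
  obtain ⟨C, hC, h⟩ := exists_abs_le (f := fun t => (f t)⁻¹) (fun t => by simp only [hp t])
    (hc.inv₀ fun t => (hf t).ne')
  refine ⟨C⁻¹, inv_pos.2 hC, fun t => ?_⟩
  have := h t
  rw [abs_of_pos (inv_pos.2 (hf t))] at this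
  exact inv_le_of_inv_le₀ (hf t) this

/-- A continuous periodic function has oscillation `≤ δ` up to a Lipschitz term. -/
theorem exists_abs_sub_le_add_mul {f : ℝ → ℝ} (hp : Function.Periodic f 1) (hc : Continuous f)
    {δ : ℝ} (hδ : 0 < δ) : ∃ K ≥ 0, ∀ a b, |f a - f b| ≤ δ + K * |a - b| := by
  obtain ⟨C, hC, hb⟩ := hp.exists_abs_le hc
  obtain ⟨η, hη, hu⟩ := hp.exists_abs_sub_lt hc hδ
  -- At distances beyond the modulus `η`, the linear term alone exceeds the total oscillation `2C`.
  refine ⟨2 * C / η, by positivity, fun a b => ?_⟩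
  rcases lt_or_ge |a - b| η with h | h
  · have : 0 ≤ 2 * C / η * |a - b| := by positivity
    linarith [hu a b h]
  · have h1 : |f a - f b| ≤ 2 * C := by
      have := abs_sub (f a) (f b)
      linarith [hb a, hb b]
    have h2 : 2 * C ≤ 2 * C / η * |a - b| := by
      rw [div_mul_eq_mul_div, le_div_iff₀ hη]
      exact mul_le_mul_of_nonneg_left h (by positivity)
    linarith

end Function.Periodic

namespace CircleDeg1Lift

theorem iterate_add_int (F : CircleDeg1Lift) (m : ℕ) (t : ℝ) (l : ℤ) :
    F^[m] (t + l) = F^[m] t + l := by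
  rw [← coe_pow, map_add_int]

theorem iterate_add_one (F : CircleDeg1Lift) (m : ℕ) (t : ℝ) :
    F^[m] (t + 1) = F^[m] t + 1 := by
  rw [← coe_pow, map_add_one]

/-- The logarithm of the derivative of `F^[m]`, written as a Birkhoff sum. -/
noncomputable def logDerivSum (F : CircleDeg1Lift) (m : ℕ) (t : ℝ) : ℝ :=
  ∑ j ∈ Finset.range m, Real.log (deriv F (F^[j] t))

namespace IsC1Diffeo

variable {F : CircleDeg1Lift}

theorem periodic_log_deriv (F : CircleDeg1Lift) :
    Function.Periodic (fun t => Real.log (deriv F t)) 1 := fun t => by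
  simp only [deriv_add_one]

theorem continuous_log_deriv (hF : F.IsC1Diffeo) :
    Continuous fun t => Real.log (deriv F t) :=
  hF.continuous_deriv.log fun t => (hF.deriv_pos t).ne'

theorem strictMono_iterate (hF : F.IsC1Diffeo) (m : ℕ) : StrictMono F^[m] :=
  hF.strictMono.iterate m

theorem continuous_iterate (hF : F.IsC1Diffeo) (m : ℕ) : Continuous F^[m] :=
  hF.continuous.iterate m

theorem continuous_logDerivSum (hF : F.IsC1Diffeo) (m : ℕ) : Continuous (F.logDerivSum m) :=
  continuous_finsetSum _ fun j _ => hF.continuous_log_deriv.comp (hF.continuous_iterate j)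

theorem periodic_logDerivSum (F : CircleDeg1Lift) (m : ℕ) :
    Function.Periodic (F.logDerivSum m) 1 := fun t => by
  simp only [logDerivSum, iterate_add_one, deriv_add_one]

theorem hasDerivAt_iterate (hF : F.IsC1Diffeo) (m : ℕ) (t : ℝ) :
    HasDerivAt F^[m] (Real.exp (F.logDerivSum m t)) t := by
  induction m with
  | zero => simpa [logDerivSum] using hasDerivAt_id t
  | succ m ih =>
    rw [Function.iterate_succ', logDerivSum, Finset.sum_range_succ, Real.exp_add,
      Real.exp_log (hF.deriv_pos _), mul_comm]
    exact (hF.hasDerivAt _).comp t ih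

/-- The Birkhoff sums of the logarithmic derivative grow slower than any linear function. -/
theorem exists_abs_logDerivSum_le {α : ℝ} {π : CircleDeg1Lift} (hF : F.IsC1Diffeo)
    (hα : Irrational α) (hπ : IsRotationSemiconj α F π) {δ : ℝ} (hδ : 0 < δ) :
    ∃ C, ∀ (m : ℕ) (t : ℝ), |F.logDerivSum m t| ≤ C + δ * m := by
  obtain ⟨K, hK, hφ⟩ := (periodic_log_deriv F).exists_abs_sub_le_add_mul
    hF.continuous_log_deriv (half_pos hδ)
  -- `M` is a block length: the Lipschitz term will cost at most `K` per block, a rate of `K / M ≤ δ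
  -- / 2`.
  obtain ⟨M, hM⟩ := exists_nat_gt (2 * K / δ)
  have hMpos : (0 : ℝ) < M := lt_of_le_of_lt (by positivity) hM
  have hM0 : 0 < M := by exact_mod_cast hMpos
  have hKM : K / M ≤ δ / 2 := by
    rw [div_lt_iff₀ hδ] at hM
    rw [div_le_iff₀ hMpos]; linarith
  obtain ⟨β, hβ, hβM⟩ := hα.exists_lt_abs_nat_mul_sub_int M
  obtain ⟨N, hN⟩ := hα.exists_nat_mul_add_int_mem_Ioo (lt_min hβ one_half_pos)
  obtain ⟨s, -, r, hs0, hs1⟩ := hN 0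
  rw [zero_add, lt_min_iff] at hs1
  -- A close return commuting with `F`. It moves `π` by less than `β`, so the first `M` images of
  -- the arc from `t` to `J t` are disjoint modulo `1`.
  set J : ℝ → ℝ := fun t => F^[s] t + r with hJ
  have hJt : ∀ t, t < J t := fun t => by
    simpa using hπ.iterate_add_lt (m := 0) (l := 0) (m' := s) (l' := r) (by simpa using hs0) t
  have hFJ : ∀ (j : ℕ) t, F^[j] (J t) = J (F^[j] t) := fun j t => by
    simp only [hJ, iterate_add_int, ← Function.iterate_add_apply, add_comm s j]
  set len : ℝ → ℝ := fun t => J t - t with hlen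
  have hlenc : Continuous len := ((hF.continuous_iterate s).add continuous_const).sub continuous_id
  have hlenp : Function.Periodic len 1 := fun t => by
    simp only [hlen, hJ, iterate_add_one]; ring
  have hlen0 : ∀ t, 0 < len t := fun t => sub_pos.2 (hJt t)
  have hπJ : ∀ t, π (J t) = π t + (s * α + r) := fun t => by
    simp only [hJ, map_add_int, hπ.map_iterate]; ring
  have hblock : ∀ t, ∑ j ∈ Finset.range M, len (F^[j] t) ≤ 1 := by
    intro t
    refine sum_length_le_one_of_disjoint_mod_one _ (fun j => F^[j] t) (fun j => J (F^[j] t))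
      (fun j _ => hJt _) ?_
    intro i hi j hj l u h1 h2 h3 h4
    rw [Finset.mem_range] at hi hj
    have p1 := π.monotone h1
    have p2 := π.monotone h2.le
    have p3 := π.monotone h3
    have p4 := π.monotone h4.le
    simp only [hπJ, hπ.map_iterate, map_add_int] at p1 p2 p3 p4
    rcases lt_trichotomy i j with hij | rfl | hij
    · have h5 := hβM (j - i) (by omega) (by omega) l
      rw [Nat.cast_sub hij.le] at h5
      exact absurd h5 (not_lt.2 (abs_le.2 ⟨by linarith, by linarith⟩))
    · refine ⟨rfl, ?_⟩
      have h5 : (-1 : ℝ) < l := by linarith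
      have h6 : (l : ℝ) < 1 := by linarith
      have h5' : -1 < l := by exact_mod_cast h5
      have h6' : l < 1 := by exact_mod_cast h6
      omega
    · have h5 := hβM (i - j) (by omega) (by omega) (-l)
      rw [Nat.cast_sub hij.le] at h5
      push_cast at h5
      exact absurd h5 (not_lt.2 (abs_le.2 ⟨by linarith, by linarith⟩))
  have hblocks : ∀ (k : ℕ) t, ∑ j ∈ Finset.range (k * M), len (F^[j] t) ≤ k := by
    intro k
    induction k with
    | zero => simp
    | succ k ih =>
      intro t
      rw [Nat.succ_mul, Finset.sum_range_add]
      have h1 := hblock (F^[k * M] t)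
      have h2 := ih t
      simp only [← Function.iterate_add_apply, add_comm _ (k * M)] at h1
      push_cast
      linarith
  have hsum : ∀ (m : ℕ) t, ∑ j ∈ Finset.range m, len (F^[j] t) ≤ m / M + 1 := by
    intro m t
    have h1 : m ≤ (m / M + 1) * M := by
      have := Nat.lt_div_mul_add (a := m) hM0
      rw [Nat.succ_mul]; omega
    have h2 : ∑ j ∈ Finset.range m, len (F^[j] t) ≤
        ∑ j ∈ Finset.range ((m / M + 1) * M), len (F^[j] t) :=
      Finset.sum_le_sum_of_subset_of_nonneg (Finset.range_mono h1) fun j _ _ => (hlen0 _).le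
    have h3 := hblocks (m / M + 1) t
    have h4 : ((m / M : ℕ) : ℝ) ≤ m / M := Nat.cast_div_le
    push_cast at h3
    linarith
  obtain ⟨C, hC, hlenC⟩ := (show Function.Periodic (fun t => Real.log (len t)) 1 from
    fun t => by simp only [hlenp t]).exists_abs_le (hlenc.log fun t => (hlen0 t).ne')
  refine ⟨2 * C + K, fun m t => ?_⟩
  -- At some `u` in the arc, the derivative of `F^[m]` is the ratio of lengths `len (F^[m] t) / len
  -- t`, bounded uniformly in `m`. It remains to bound the distortion between `t` and `u`.
  obtain ⟨u, ⟨hu1, hu2⟩, hu⟩ := exists_hasDerivAt_eq_slope F^[m]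
    (fun u => Real.exp (F.logDerivSum m u)) (hJt t) (hF.continuous_iterate m).continuousOn
    fun u _ => hF.hasDerivAt_iterate m u
  rw [hFJ] at hu
  have hu' : F.logDerivSum m u = Real.log (len (F^[m] t)) - Real.log (len t) := by
    rw [← Real.log_exp (F.logDerivSum m u), hu, Real.log_div (hlen0 _).ne' (hlen0 t).ne']
  have h1 : |F.logDerivSum m t - F.logDerivSum m u| ≤ m * (δ / 2) + K * (m / M + 1) := by
    rw [logDerivSum, logDerivSum, ← Finset.sum_sub_distrib]
    refine (Finset.abs_sum_le_sum_abs _ _).trans ?_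
    have h2 : ∀ j ∈ Finset.range m, |Real.log (deriv F (F^[j] t)) - Real.log (deriv F (F^[j] u))|
        ≤ δ / 2 + K * len (F^[j] t) := by
      intro j _
      refine (hφ _ _).trans (add_le_add_right (mul_le_mul_of_nonneg_left ?_ hK) _)
      have h3 := (hF.strictMono_iterate j).monotone hu1.le
      have h4 := (hF.strictMono_iterate j).monotone hu2.le
      rw [hFJ] at h4
      simp only [hlen]
      rw [abs_le]; constructor <;> linarith
    refine (Finset.sum_le_sum h2).trans ?_
    rw [Finset.sum_add_distrib, ← Finset.mul_sum]
    simp only [Finset.sum_const, Finset.card_range, nsmul_eq_mul]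
    exact add_le_add_right (mul_le_mul_of_nonneg_left (hsum m t) hK) _
  have h2 : |F.logDerivSum m u| ≤ 2 * C := by
    rw [hu']
    have := abs_sub (Real.log (len (F^[m] t))) (Real.log (len t))
    linarith [hlenC (F^[m] t), hlenC t]
  have h3 : |F.logDerivSum m t| ≤ |F.logDerivSum m t - F.logDerivSum m u| + |F.logDerivSum m u| := by
    have := abs_add_le (F.logDerivSum m t - F.logDerivSum m u) (F.logDerivSum m u)
    rwa [sub_add_cancel] at this
  have h4 : K * (m / M + 1) ≤ δ / 2 * m + K := by
    have : K * (m / M) = K / M * m := by ring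
    rw [mul_add, this, mul_one]
    exact add_le_add_left (mul_le_mul_of_nonneg_right hKM (Nat.cast_nonneg m)) _
  linarith

end IsC1Diffeo

end CircleDeg1Lift

/-! ### Conjugating a circle diffeomorphism close to a rotation -/

namespace CircleDeg1Lift

/-- A positive continuous periodic function is, up to a constant factor, the derivative of a lift
of a circle diffeomorphism. -/
theorem exists_deriv_eq_div {D : ℝ → ℝ} (hD : Continuous D) (hp : Function.Periodic D 1)
    (hpos : ∀ t, 0 < D t) (t₀ v₀ : ℝ) :
    ∃ P : CircleDeg1Lift, P.IsC1Diffeo ∧ P t₀ = v₀ ∧ ∃ Z > 0, ∀ t, deriv P t = D t / Z ∧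
      Z = ∫ s in (0 : ℝ)..1, D s := by
  set Z : ℝ := ∫ s in (0 : ℝ)..1, D s with hZ
  have hZ0 : 0 < Z := intervalIntegral.intervalIntegral_pos_of_pos
    (hD.intervalIntegrable _ _) hpos zero_lt_one
  set f : ℝ → ℝ := fun t => v₀ + (∫ s in t₀..t, D s) / Z with hf
  have hder : ∀ t, HasDerivAt f (D t / Z) t := fun t =>
    ((hD.integral_hasStrictDerivAt t₀ t).hasDerivAt.div_const Z).const_add v₀
  have hmono : StrictMono f := strictMono_of_deriv_pos fun t => by
    rw [(hder t).deriv]; exact div_pos (hpos t) hZ0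
  have hadd : ∀ t, f (t + 1) = f t + 1 := by
    intro t
    have h1 := intervalIntegral.integral_add_adjacent_intervals
      (hD.intervalIntegrable (μ := MeasureTheory.volume) t₀ t) (hD.intervalIntegrable t (t + 1))
    have h2 : ∫ s in t..t + 1, D s = Z := by
      rw [hp.intervalIntegral_add_eq t 0, zero_add]
    simp only [hf]
    rw [← h1, h2, add_div, div_self hZ0.ne']; ring
  let P : CircleDeg1Lift := ⟨⟨f, hmono.monotone⟩, hadd⟩
  have hP : ∀ t, HasDerivAt P (D t / Z) t := hder
  refine ⟨P, IsC1Diffeo.of_hasDerivAt hP (hD.div_const Z) fun t => div_pos (hpos t) hZ0, ?_,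
    Z, hZ0, fun t => ⟨(hP t).deriv, rfl⟩⟩
  change v₀ + (∫ s in t₀..t₀, D s) / Z = v₀
  simp

theorem exists_int_le_le_add_one (s t : ℝ) : ∃ l : ℤ, t ≤ s + l ∧ s + l ≤ t + 1 := by
  refine ⟨⌈t - s⌉, ?_, ?_⟩
  · linarith [Int.le_ceil (t - s)]
  · linarith [Int.ceil_lt_add_one (t - s)]

variable {α : ℝ} {F π P : CircleDeg1Lift}

/-- If the conjugate of `F` by `P` has derivative close to `1`, then it is close to a rotation. -/
theorem IsRotationSemiconj.abs_conj_sub_le (hπ : IsRotationSemiconj α F π) (hF : F.IsC1Diffeo)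
    (hP : P.IsC1Diffeo) {ε : ℝ} (hε : 0 < ε)
    (h : ∀ t, |deriv P (F t) * deriv F t / deriv P t - 1| ≤ ε) (t : ℝ) :
    |P (F t) - P t - α| ≤ 2 * ε := by
  set g : ℝ → ℝ := fun t => P (F t) - P t with hg
  have hder : ∀ t, HasDerivAt g (deriv P (F t) * deriv F t - deriv P t) t := fun t =>
    ((hP.hasDerivAt (F t)).comp t (hF.hasDerivAt t)).sub (hP.hasDerivAt t)
  have hbd : ∀ t, |deriv P (F t) * deriv F t - deriv P t| ≤ ε * deriv P t := by
    intro t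
    have h1 := h t
    have h2 := hP.deriv_pos t
    rwa [div_sub_one h2.ne', abs_div, abs_of_pos h2, div_le_iff₀ h2] at h1
  -- Since `|g'| ≤ ε P'`, both `ε P - g` and `ε P + g` are monotone; as `P` gains `1` per period,
  -- `g` oscillates by at most `ε`.
  have hm1 : Monotone fun t => ε * P t - g t := by
    have hd : ∀ t, HasDerivAt (fun t => ε * P t - g t)
        (ε * deriv P t - (deriv P (F t) * deriv F t - deriv P t)) t := fun t =>
      ((hP.hasDerivAt t).const_mul ε).sub (hder t)
    refine monotone_of_deriv_nonneg (fun t => (hd t).differentiableAt) fun t => ?_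
    rw [(hd t).deriv]
    linarith [(abs_le.1 (hbd t)).2]
  have hm2 : Monotone fun t => ε * P t + g t := by
    have hd : ∀ t, HasDerivAt (fun t => ε * P t + g t)
        (ε * deriv P t + (deriv P (F t) * deriv F t - deriv P t)) t := fun t =>
      ((hP.hasDerivAt t).const_mul ε).add (hder t)
    refine monotone_of_deriv_nonneg (fun t => (hd t).differentiableAt) fun t => ?_
    rw [(hd t).deriv]
    linarith [(abs_le.1 (hbd t)).1]
  have hgint : ∀ s (l : ℤ), g (s + l) = g s := fun s l => by
    simp only [hg, map_add_int]; ring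
  have hosc : ∀ s t, |g s - g t| ≤ ε := by
    intro s t
    obtain ⟨l, h1, h2⟩ := exists_int_le_le_add_one s t
    have h3 := hm1 h1
    have h4 := hm2 h1
    simp only [hgint] at h3 h4
    have h5 : P (s + l) ≤ P t + 1 := by rw [← map_add_one]; exact P.monotone h2
    have h6 : ε * P (s + l) ≤ ε * (P t + 1) := mul_le_mul_of_nonneg_left h5 hε.le
    rw [abs_le]; constructor <;> linarith
  -- `P` and `π` advance alike up to a bounded error. A value of `g` off `α` by more than `2ε` would
  -- force all values off by `ε`, hence an unbounded drift.
  have hiter : ∀ (n : ℕ), |P (F^[n] t) - P t - n * α| ≤ 2 := by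
    intro n
    have h1 := abs_le.1 (abs_sub_sub_le_one P (F^[n] t) t)
    have h2 := abs_le.1 (abs_sub_sub_le_one π (F^[n] t) t)
    have h3 := hπ.map_iterate n t
    rw [abs_le]; constructor <;> linarith
  obtain ⟨n, hn⟩ := exists_nat_gt (2 / ε)
  rw [div_lt_iff₀ hε] at hn
  have hstep : ∀ (n : ℕ) , P (F^[n + 1] t) - P (F^[n] t) = g (F^[n] t) := fun n => by
    rw [Function.iterate_succ_apply']
  rw [abs_le]
  constructor <;> by_contra! hcon
  · have hup : ∀ n : ℕ, P (F^[n] t) - P t ≤ n * (α - ε) := by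
      intro n
      induction n with
      | zero => simp
      | succ n ih =>
        have h1 := hstep n
        have h2 := (abs_le.1 (hosc (F^[n] t) t)).2
        have h3 : g t < α - 2 * ε := by linarith
        push_cast; linarith
    have h1 := hup n
    have h2 := (abs_le.1 (hiter n)).1
    linarith
  · have hup : ∀ n : ℕ, n * (α + ε) ≤ P (F^[n] t) - P t := by
      intro n
      induction n with
      | zero => simp
      | succ n ih =>
        have h1 := hstep n
        have h2 := (abs_le.1 (hosc (F^[n] t) t)).1
        have h3 : α + 2 * ε < g t := by linarith
        push_cast; linarith
    have h1 := hup n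
    have h2 := (abs_le.1 (hiter n)).2
    linarith

/-- If the conjugate of `F` by `P` is close to a rotation, then `P` is close to `π`. -/
theorem IsRotationSemiconj.abs_sub_sub_le (hπ : IsRotationSemiconj α F π) {ε η : ℝ}
    {N : ℕ} (hε : 0 ≤ ε)
    (hN : ∀ θ : ℝ, ∃ m < N, ∃ l : ℤ, θ < (m : ℝ) * α + l ∧ (m : ℝ) * α + l < θ + η)
    (hNε : N * ε ≤ η) (h : ∀ t, |P (F t) - P t - α| ≤ ε) (s t : ℝ) :
    |(P s - P t) - (π s - π t)| ≤ 2 * η := by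
  have hiter : ∀ m : ℕ, m ≤ N → |P (F^[m] t) - P t - m * α| ≤ η := by
    intro m hm
    have h1 : |P (F^[m] t) - P t - m * α| ≤ m * ε := by
      clear hm
      induction m with
      | zero => simp
      | succ m ih =>
        rw [Function.iterate_succ_apply']
        have h1 := abs_le.1 (h (F^[m] t))
        have h2 := abs_le.1 ih
        push_cast
        rw [abs_le]; constructor <;> linarith
    exact (h1.trans (mul_le_mul_of_nonneg_right (by exact_mod_cast hm) hε)).trans hNε
  -- `s` is enclosed between two translated orbit points of `t` whose `π`-values are within `η` of
  -- `π s`; along this orbit `P` and `π` advance equally up to `η`.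
  obtain ⟨m, hm, l, h1, h2⟩ := hN (π s - π t)
  obtain ⟨m', hm', l', h1', h2'⟩ := hN (π s - π t - η)
  have h3 : P s ≤ P (F^[m] t) + l := by
    rw [← map_add_int]
    exact P.monotone (hπ.lt_iterate_add (by linarith)).le
  have h4 : P (F^[m'] t) + l' ≤ P s := by
    rw [← map_add_int]
    exact P.monotone (hπ.iterate_add_lt' (by linarith)).le
  have h5 := abs_le.1 (hiter m hm.le)
  have h6 := abs_le.1 (hiter m' hm'.le)
  rw [abs_le]; constructor <;> linarith

/-- The Birkhoff averages solve the cohomological equation for `log F'` approximately. -/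
theorem IsC1Diffeo.exists_abs_log_deriv_add_sub_le (hF : F.IsC1Diffeo) (hα : Irrational α)
    (hπ : IsRotationSemiconj α F π) {ε : ℝ} (hε : 0 < ε) :
    ∃ u : ℝ → ℝ, Continuous u ∧ Function.Periodic u 1 ∧
      ∀ t, |Real.log (deriv F t) + u (F t) - u t| ≤ ε := by
  obtain ⟨C, hC⟩ := hF.exists_abs_logDerivSum_le hα hπ (half_pos hε)
  obtain ⟨N, hN⟩ := exists_nat_gt (max 0 (2 * C / ε))
  have hN0 : (0 : ℝ) < N := (le_max_left _ _).trans_lt hN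
  have hNC : 2 * C / ε < N := (le_max_right _ _).trans_lt hN
  rw [div_lt_iff₀ hε] at hNC
  -- For this average the defect telescopes to `F.logDerivSum N t / N`.
  refine ⟨fun t => (∑ k ∈ Finset.range N, F.logDerivSum k t) / N,
    (continuous_finsetSum _ fun k _ => hF.continuous_logDerivSum k).div_const _,
    fun t => ?_, fun t => ?_⟩
  · simp only [periodic_logDerivSum F _ t]
  · have h1 : ∀ k, F.logDerivSum k (F t) = F.logDerivSum (k + 1) t - Real.log (deriv F t) := by
      intro k
      simp only [logDerivSum, Finset.sum_range_succ', Function.iterate_succ_apply,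
        Function.iterate_zero_apply]
      ring
    have h2 : ∑ k ∈ Finset.range N, F.logDerivSum k (F t) =
        F.logDerivSum N t + ∑ k ∈ Finset.range N, F.logDerivSum k t -
          N * Real.log (deriv F t) := by
      have h3 := Finset.sum_range_sub (fun k => F.logDerivSum k t) N
      have h4 : F.logDerivSum 0 t = 0 := by simp [logDerivSum]
      rw [Finset.sum_sub_distrib, h4] at h3
      simp only [h1, Finset.sum_sub_distrib, Finset.sum_const, Finset.card_range, nsmul_eq_mul]
      linarith
    have h5 : Real.log (deriv F t) + (∑ k ∈ Finset.range N, F.logDerivSum k (F t)) / N -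
        (∑ k ∈ Finset.range N, F.logDerivSum k t) / N = F.logDerivSum N t / N := by
      rw [h2]; field_simp; ring
    rw [h5, abs_div, abs_of_pos hN0, div_le_iff₀ hN0]
    have := hC N t
    linarith

end CircleDeg1Lift

/-! ### Localizing the solution of the cohomological equation -/

namespace CircleDeg1Lift

variable {α : ℝ} {F π : CircleDeg1Lift}

theorem zpow_apply_apply (E : CircleDeg1Liftˣ) (m : ℤ) (t : ℝ) :
    ((E ^ m : CircleDeg1Liftˣ) : CircleDeg1Lift) ((E : CircleDeg1Lift) t) =
      ((E ^ (m + 1) : CircleDeg1Liftˣ) : CircleDeg1Lift) t := by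
  rw [zpow_add_one, Units.val_mul, mul_apply]

theorem continuous_units (E : CircleDeg1Liftˣ) : Continuous (E : CircleDeg1Lift) :=
  (toOrderIso E).continuous

theorem IsRotationSemiconj.map_zpow {E : CircleDeg1Liftˣ} (h : IsRotationSemiconj α E π) (m : ℤ) :
    ∀ t : ℝ, π (((E ^ m : CircleDeg1Liftˣ) : CircleDeg1Lift) t) = π t + m * α := by
  induction m using Int.induction_on with
  | zero => simp
  | succ i ih =>
    intro t
    rw [← zpow_apply_apply, ih, h.map]; push_cast; ring
  | pred i ih =>
    intro t
    obtain ⟨s, rfl⟩ : ∃ s, (E : CircleDeg1Lift) s = t := ⟨_, units_apply_inv_apply E t⟩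
    rw [zpow_apply_apply, sub_add_cancel, ih, h.map]; push_cast; ring

/-- Summation by parts against a weight `c` with small increments, for a sequence `a` with at most
one nonzero term where `c` varies. -/
theorem abs_tsum_sub_tsum_le {c a : ℤ → ℝ} {L : ℤ} {δ W : ℝ} (hc : ∀ m, L < |m| → c m = 0)
    (hδ : ∀ m, |c (m + 1) - c m| ≤ δ) (hW : ∀ m, |a m| ≤ W)
    (ha : ∀ m m', |m| ≤ L + 1 → |m'| ≤ L + 1 → a m ≠ 0 → a m' ≠ 0 → m = m') :
    |∑' m, c m * a (m - 1) - ∑' m, c m * a m| ≤ δ * W := by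
  have hδ0 : 0 ≤ δ := (abs_nonneg _).trans (hδ 0)
  have hW0 : 0 ≤ W := (abs_nonneg _).trans (hW 0)
  have hfin : (Set.Icc (-(L + 1)) (L + 1)).Finite := Set.finite_Icc _ _
  have hc' : ∀ m, m ∉ Set.Icc (-(L + 1)) (L + 1) → c m = 0 ∧ c (m + 1) = 0 := by
    intro m hm
    have h1 : L + 1 < |m| := by
      by_contra! h
      exact hm ⟨(abs_le.1 h).1, (abs_le.1 h).2⟩
    refine ⟨hc m (by omega), hc _ ?_⟩
    rcases le_or_gt 0 m with h0 | h0
    · rw [abs_of_nonneg h0] at h1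
      rw [abs_of_nonneg (by omega)]; omega
    · rw [abs_of_neg h0] at h1
      rcases le_or_gt 0 (m + 1) with h2 | h2
      · rw [abs_of_nonneg h2]; omega
      · rw [abs_of_neg h2]; omega
  have h1 : ∑' m, c m * a (m - 1) = ∑' m, c (m + 1) * a m := by
    rw [← (Equiv.addRight (1 : ℤ)).tsum_eq fun m => c m * a (m - 1)]
    simp
  have hs1 : Summable fun m => c (m + 1) * a m := summable_of_hasFiniteSupport <|
    hfin.subset fun m hm => by
      by_contra h; exact hm (by simp [(hc' m h).2])
  have hs2 : Summable fun m => c m * a m := summable_of_hasFiniteSupport <|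
    hfin.subset fun m hm => by
      by_contra h; exact hm (by simp [(hc' m h).1])
  rw [h1, ← hs1.tsum_sub hs2]
  have hzero : ∀ m, ¬ |m| ≤ L + 1 → c (m + 1) * a m - c m * a m = 0 := by
    intro m hm
    have := hc' m fun h => hm (abs_le.2 h)
    rw [this.1, this.2]; ring
  by_cases hex : ∃ m, |m| ≤ L + 1 ∧ a m ≠ 0
  · obtain ⟨m, hm, ham⟩ := hex
    rw [tsum_eq_single m, ← sub_mul, abs_mul]
    · exact mul_le_mul (hδ m) (hW m) (abs_nonneg _) hδ0
    · intro m' hm'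
      by_cases h2 : |m'| ≤ L + 1
      · have : a m' = 0 := by
          by_contra h3
          exact hm' (ha _ _ h2 hm h3 ham)
        simp [this]
      · exact hzero m' h2
  · push Not at hex
    have : (fun m => c (m + 1) * a m - c m * a m) = fun _ => 0 := by
      funext m
      by_cases h2 : |m| ≤ L + 1
      · simp [hex m h2]
      · exact hzero m h2
    rw [this, tsum_zero, abs_zero]; positivity

/-- The approximate solution of the cohomological equation may be chosen to vanish near the
fibres of `π` through `t₀` and its antipode. -/
theorem IsC1Diffeo.exists_vanishing_abs_log_deriv_add_sub_le (hF : F.IsC1Diffeo)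
    (hα : Irrational α) (hπ : IsRotationSemiconj α F π) (t₀ : ℝ) {ε : ℝ} (hε : 0 < ε) :
    ∃ κ > 0, ∃ v : ℝ → ℝ, Continuous v ∧ Function.Periodic v 1 ∧
      (∀ t, |Real.log (deriv F t) + v (F t) - v t| ≤ ε) ∧
      ∀ (t : ℝ) (l : ℤ), |2 * (π t - π t₀) - l| ≤ κ → v t = 0 := by
  obtain ⟨u, huc, hup, hu⟩ := hF.exists_abs_log_deriv_add_sub_le hα hπ (half_pos hε)
  obtain ⟨W, hW0, hW⟩ := hup.exists_abs_le huc
  obtain ⟨M, hM⟩ := exists_nat_gt (2 * W / ε)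
  have hM0 : (0 : ℝ) < M := lt_of_le_of_lt (by positivity) hM
  have hMW : 1 / M * W ≤ ε / 2 := by
    rw [div_lt_iff₀ hε] at hM
    rw [div_mul_eq_mul_div, div_le_iff₀ hM0]; linarith
  have h2α : Irrational (2 * α) := by simpa using hα.natCast_mul (m := 2) (by norm_num)
  -- Doubling the angle merges the two fibres into one point, moved by the rotation by `2α`. Indices
  -- up to `M + 1` in absolute value differ by at most `2M + 2`.
  obtain ⟨κ, hκ, hκM⟩ := h2α.exists_lt_abs_nat_mul_sub_int (2 * M + 2)
  obtain ⟨E, rfl⟩ := hF.isUnit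
  set ρ : ℝ → ℝ := fun t => ‖((2 * (π t - π t₀) : ℝ) : UnitAddCircle)‖ with hρ
  have hρc : Continuous ρ := by
    have h1 : Continuous ((↑) : ℝ → UnitAddCircle) := continuous_quotient_mk'
    exact (h1.comp (continuous_const.mul (hπ.continuous.sub continuous_const))).norm
  have hρp : Function.Periodic ρ 1 := by
    intro t
    have : (2 * (π (t + 1) - π t₀) : ℝ) = 2 * (π t - π t₀) + (2 : ℤ) := by
      rw [map_add_one]; push_cast; ring
    simp only [hρ, this, UnitAddCircle.norm_eq, round_add_intCast]
    push_cast; ring_nf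
  have hρle : ∀ (t : ℝ) (l : ℤ), ρ t ≤ |2 * (π t - π t₀) - l| := fun t l => by
    simp only [hρ, UnitAddCircle.norm_eq]
    exact round_le _ l
  set χ : ℝ → ℝ := fun t => max 0 (min 1 (2 - 4 * ρ t / κ)) with hχ
  have hχ01 : ∀ t, |χ t| ≤ 1 := fun t => by
    rw [abs_of_nonneg (le_max_left _ _)]
    exact max_le zero_le_one (min_le_left _ _)
  have hχ0 : ∀ t, κ / 2 ≤ ρ t → χ t = 0 := fun t ht => by
    refine max_eq_left ((min_le_right _ _).trans ?_)
    rw [sub_nonpos, le_div_iff₀ hκ]; linarith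
  have hχ1 : ∀ t, ρ t ≤ κ / 4 → χ t = 1 := fun t ht => by
    have : 1 ≤ 2 - 4 * ρ t / κ := by
      have : 4 * ρ t / κ ≤ 1 := by rw [div_le_iff₀ hκ]; linarith
      linarith
    simp only [hχ, min_eq_left this]; simp
  set pw : ℤ → ℝ → ℝ := fun m => ((E ^ m : CircleDeg1Liftˣ) : CircleDeg1Lift) with hpw
  have hpw0 : ∀ t, pw 0 t = t := fun t => by simp [hpw]
  have hpws : ∀ m t, pw m ((E : CircleDeg1Lift) t) = pw (m + 1) t := zpow_apply_apply E
  set w : ℝ → ℝ := fun t => χ t * u t with hw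
  have hwc : Continuous w := Continuous.mul (by fun_prop) huc
  have hwp : Function.Periodic w 1 := fun t => by simp only [hw, hχ, hρp t, hup t]
  have hwW : ∀ t, |w t| ≤ W := fun t => by
    rw [abs_mul]
    exact (mul_le_of_le_one_left (abs_nonneg _) (hχ01 t)).trans (hW t)
  have hwρ : ∀ t, w t ≠ 0 → ρ t < κ / 2 := fun t ht => by
    by_contra! h
    exact ht (by simp only [hw, hχ0 t h, zero_mul])
  have hsep : ∀ t (m m' : ℤ), |m - m'| ≤ 2 * M + 2 → ρ (pw (-m) t) < κ / 2 →
      ρ (pw (-m') t) < κ / 2 → m = m' := by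
    intro t m m' hmm h1 h2
    by_contra hne
    simp only [hρ, UnitAddCircle.norm_eq, hpw, hπ.map_zpow] at h1 h2
    set l := round (2 * (π t + ((-m : ℤ) : ℝ) * α - π t₀))
    set l' := round (2 * (π t + ((-m' : ℤ) : ℝ) * α - π t₀))
    push_cast at h1 h2
    obtain ⟨h3, h4⟩ := abs_lt.1 h1
    obtain ⟨h5, h6⟩ := abs_lt.1 h2
    rcases lt_or_gt_of_ne hne with hlt | hlt
    · obtain ⟨d, hd⟩ := Int.eq_ofNat_of_zero_le (sub_nonneg.2 hlt.le)
      have h7 := hκM d (by omega) (by rw [abs_le] at hmm; omega) (l - l')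
      have h8 : (d : ℝ) = m' - m := by exact_mod_cast hd.symm
      rw [h8] at h7
      push_cast at h7
      refine absurd h7 (not_lt.2 (abs_le.2 ⟨by linarith, by linarith⟩))
    · obtain ⟨d, hd⟩ := Int.eq_ofNat_of_zero_le (sub_nonneg.2 hlt.le)
      have h7 := hκM d (by omega) (by rw [abs_le] at hmm; omega) (l' - l)
      have h8 : (d : ℝ) = m - m' := by exact_mod_cast hd.symm
      rw [h8] at h7
      push_cast at h7
      refine absurd h7 (not_lt.2 (abs_le.2 ⟨by linarith, by linarith⟩))
  -- Subtracting the localized part `w` of `u` alone would spoil the equation. It is spread along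
  -- the orbit with tent weights: where `χ = 1` only the term `c 0 = 1` survives and `T = u`, while
  -- `T ∘ F - T` involves increments of `c`, of size at most `1 / M`, one at a time.
  set c : ℤ → ℝ := fun m => max 0 (1 - |(m : ℝ)| / M) with hc
  have hc0 : ∀ m : ℤ, (M : ℤ) < |m| → c m = 0 := fun m hm => by
    refine max_eq_left ?_
    rw [sub_nonpos, le_div_iff₀ hM0, one_mul]
    have : ((M : ℤ) : ℝ) < ((|m| : ℤ) : ℝ) := by exact_mod_cast hm
    push_cast at this
    exact this.le
  have hcd : ∀ m : ℤ, |c (m + 1) - c m| ≤ 1 / M := fun m => by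
    refine (abs_max_sub_max_le_max _ _ _ _).trans ?_
    rw [sub_self, abs_zero, max_eq_right (abs_nonneg _), sub_sub_sub_cancel_left, ← sub_div,
      abs_div, abs_of_pos hM0]
    refine div_le_div_of_nonneg_right ?_ hM0.le
    refine (abs_abs_sub_abs_le_abs_sub _ _).trans ?_
    push_cast; simp
  set T : ℝ → ℝ := fun t => ∑' m : ℤ, c m * w (pw (-m) t) with hT
  have hTs : ∀ t, T t = ∑ m ∈ Finset.Icc (-(M : ℤ)) M, c m * w (pw (-m) t) := fun t => by
    refine tsum_eq_sum fun m hm => ?_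
    rw [hc0 m, zero_mul]
    by_contra! h
    exact hm (Finset.mem_Icc.2 (abs_le.1 h))
  refine ⟨κ / 4, by positivity, fun t => u t - T t, ?_, ?_, ?_, ?_⟩
  · have : T = fun t => ∑ m ∈ Finset.Icc (-(M : ℤ)) M, c m * w (pw (-m) t) := funext hTs
    rw [this]
    exact huc.sub (continuous_finsetSum _ fun m _ =>
      continuous_const.mul (hwc.comp (continuous_units (E ^ (-m)))))
  · intro t
    simp only [hT, hpw, map_add_one, hup t, hwp _]
  · intro t
    have h1 : T ((E : CircleDeg1Lift) t) = ∑' m : ℤ, c m * w (pw (-(m - 1)) t) := by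
      simp only [hT]
      refine tsum_congr fun m => ?_
      rw [hpws, neg_sub, sub_eq_neg_add 1 m]
    have h2 := abs_tsum_sub_tsum_le (c := c) (a := fun m => w (pw (-m) t)) (L := M) hc0 hcd
      (fun m => hwW _) fun m m' hm hm' h2 h3 =>
        hsep t m m' (by rw [abs_le] at *; omega) (hwρ _ h2) (hwρ _ h3)
    rw [← h1] at h2
    have h3 := abs_le.1 (h2.trans hMW)
    have h4 := abs_le.1 (hu t)
    simp only [hT] at h3 ⊢
    rw [abs_le]; constructor <;> linarith
  · intro t l ht
    have h1 : χ t = 1 := hχ1 t ((hρle t l).trans ht)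
    have hρt : ρ (pw (-0) t) < κ / 2 := by
      rw [neg_zero, hpw0]
      exact ((hρle t l).trans ht).trans_lt (by linarith)
    have h2 : T t = c 0 * w (pw (-0) t) := by
      refine tsum_eq_single 0 fun m hm => ?_
      by_cases hmM : (M : ℤ) < |m|
      · rw [hc0 m hmM, zero_mul]
      · have : w (pw (-m) t) = 0 := by
          by_contra h3
          refine hm (hsep t m 0 ?_ (hwρ _ h3) hρt)
          rw [sub_zero]; omega
        rw [this, mul_zero]
    show u t - T t = 0
    rw [h2]
    simp [hpw0, hw, h1, hc]

/-- `F` can be conjugated as `C¹`-close to a rotation as desired, by a diffeomorphism with locally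
constant derivative near the fibres of `π` through `t₀` and its antipode. -/
theorem IsC1Diffeo.exists_conj_close_to_rotation (hF : F.IsC1Diffeo)
    (hα : Irrational α) (hπ : IsRotationSemiconj α F π) (t₀ : ℝ) {ε κ : ℝ} (hε : 0 < ε)
    (hκ : 0 < κ) :
    ∃ κ' > 0, ∃ P : CircleDeg1Lift, P.IsC1Diffeo ∧ P t₀ = 0 ∧
      (∀ t, |P (F t) - P t - α| ≤ ε) ∧
      (∀ t, |deriv P (F t) * deriv F t / deriv P t - 1| ≤ ε) ∧
      ∃ c > 0, ∀ (t : ℝ) (l : ℤ), |2 * (π t - π t₀) - l| ≤ κ' →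
        deriv P t = c ∧ |2 * P t - l| ≤ κ := by
  obtain ⟨N, hN⟩ := hα.exists_nat_mul_add_int_mem_Ioo (show 0 < κ / 8 by positivity)
  obtain ⟨ε', hε'0, hε'1, hε'ε, hNε⟩ : ∃ ε' > 0, ε' ≤ 1 ∧ 2 * ε' ≤ ε ∧ N * (2 * ε') ≤ κ / 8 := by
    refine ⟨min 1 (min (ε / 2) (κ / 16 / (N + 1))), by positivity, min_le_left _ _, ?_, ?_⟩
    · have := (min_le_right 1 (min (ε / 2) (κ / 16 / (N + 1)))).trans (min_le_left _ _)
      linarith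
    · have h1 := (min_le_right 1 (min (ε / 2) (κ / 16 / (N + 1)))).trans (min_le_right _ _)
      rw [le_div_iff₀ (by positivity)] at h1
      have h2 : 0 ≤ min 1 (min (ε / 2) (κ / 16 / (N + 1))) := by positivity
      linarith
  obtain ⟨κ₁, hκ₁, v, hvc, hvp, hv, hv0⟩ :=
    hF.exists_vanishing_abs_log_deriv_add_sub_le hα hπ t₀ (half_pos hε'0)
  obtain ⟨P, hP, hP0, Z, hZ, hPd⟩ := exists_deriv_eq_div (D := fun t => Real.exp (v t))
    hvc.rexp (fun t => by simp only [hvp t]) (fun t => Real.exp_pos _) t₀ 0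
  have hder : ∀ t, |deriv P (F t) * deriv F t / deriv P t - 1| ≤ ε' := by
    intro t
    -- The normalizing constant `Z` cancels in the derivative of the conjugate.
    have h1 : deriv P (F t) * deriv F t / deriv P t =
        Real.exp (Real.log (deriv F t) + v (F t) - v t) := by
      rw [(hPd t).1, (hPd (F t)).1, Real.exp_sub, Real.exp_add, Real.exp_log (hF.deriv_pos t)]
      field_simp
    rw [h1]
    refine (Real.abs_exp_sub_one_le ((hv t).trans (by linarith))).trans ?_
    linarith [hv t]
  have hrot := hπ.abs_conj_sub_le hF hP hε'0 hder
  -- `P` is close to `π - π t₀`, so it carries neighbourhoods of the two fibres near the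
  -- half-integers, the region where the second conjugacy will be affine.
  have hclose := fun t => hπ.abs_sub_sub_le (by positivity) hN hNε hrot t t₀
  refine ⟨min κ₁ (κ / 2), by positivity, P, hP, hP0, fun t => (hrot t).trans hε'ε,
    fun t => (hder t).trans (by linarith), 1 / Z, by positivity, fun t l ht => ⟨?_, ?_⟩⟩
  · rw [(hPd t).1, hv0 t l (ht.trans (min_le_left _ _)), Real.exp_zero]
  · have h1 := abs_le.1 (hclose t)
    have h2 := abs_le.1 (ht.trans (min_le_right _ _))
    rw [hP0] at h1
    rw [abs_le]; constructor <;> linarith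

end CircleDeg1Lift

/-! ### Denjoy's theorem -/

/-- Take the first return closer than `min β 1`, where `β` bounds from below the returns up to time
`Q`: all earlier ones are farther. Such times feed Denjoy's argument. -/
theorem Irrational.exists_closest_return {α : ℝ} (hα : Irrational α) (Q : ℕ) :
    ∃ q : ℕ, Q < q ∧ ∃ p : ℤ, |(q : ℝ) * α - p| < 1 ∧
      ∀ j : ℕ, 0 < j → j < q → ∀ l : ℤ, |(q : ℝ) * α - p| < |(j : ℝ) * α - l| := by
  classical
  obtain ⟨β, hβ, hβQ⟩ := hα.exists_lt_abs_nat_mul_sub_int Q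
  have hβ' : 0 < min β 1 := lt_min hβ one_pos
  have hex : ∃ q : ℕ, 0 < q ∧ ∃ p : ℤ, |(q : ℝ) * α - p| < min β 1 := by
    obtain ⟨N, hN⟩ := hα.exists_nat_mul_add_int_mem_Ioo hβ'
    obtain ⟨m, -, l, h1, h2⟩ := hN (-α)
    refine ⟨m + 1, Nat.succ_pos m, -l, ?_⟩
    push_cast
    rw [abs_lt]; constructor <;> linarith
  obtain ⟨hq, p, hp⟩ := Nat.find_spec hex
  refine ⟨Nat.find hex, ?_, p, hp.trans_le (min_le_right _ _), fun j hj hjq l => ?_⟩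
  · by_contra! h
    exact lt_asymm (hβQ _ hq h p) (hp.trans_le (min_le_left _ _))
  · by_contra! h
    exact Nat.find_min hex hjq ⟨hj, l, h.trans_lt hp⟩

namespace CircleDeg1Lift

variable {α : ℝ} {F π : CircleDeg1Lift}

/-- Bounded distortion: over the time before a return, intervals joining a point to its close
return have disjoint iterates. -/
theorem IsC1Diffeo.abs_logDerivSum_sub_le (hF : F.IsC1Diffeo) (hπ : IsRotationSemiconj α F π)
    {V : ℝ} (hV : 0 ≤ V)
    (hlip : ∀ a b, |Real.log (deriv F a) - Real.log (deriv F b)| ≤ V * |a - b|)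
    {q : ℕ} {δ : ℝ} (hδ1 : δ < 1)
    (hq : ∀ j : ℕ, 0 < j → j < q → ∀ l : ℤ, δ < |(j : ℝ) * α - l|)
    {x y : ℝ} (hxy : x < y) (hπxy : π y - π x ≤ δ) {u v : ℝ} (hu : u ∈ Set.Icc x y)
    (hv : v ∈ Set.Icc x y) :
    |F.logDerivSum q u - F.logDerivSum q v| ≤ V := by
  have hsum : ∑ j ∈ Finset.range q, (F^[j] y - F^[j] x) ≤ 1 := by
    refine sum_length_le_one_of_disjoint_mod_one _ _ _
      (fun j _ => hF.strictMono_iterate j hxy) ?_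
    intro i hi j hj l u h1 h2 h3 h4
    rw [Finset.mem_range] at hi hj
    have p1 := π.monotone h1
    have p2 := π.monotone h2.le
    have p3 := π.monotone h3
    have p4 := π.monotone h4.le
    simp only [hπ.map_iterate, map_add_int] at p1 p2 p3 p4
    rcases lt_trichotomy i j with hij | rfl | hij
    · have h5 := hq (j - i) (by omega) (by omega) l
      rw [Nat.cast_sub hij.le] at h5
      exact absurd h5 (not_lt.2 (abs_le.2 ⟨by linarith, by linarith⟩))
    · refine ⟨rfl, ?_⟩
      have h5 : (-1 : ℝ) < l := by linarith
      have h6 : (l : ℝ) < 1 := by linarith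
      have h5' : -1 < l := by exact_mod_cast h5
      have h6' : l < 1 := by exact_mod_cast h6
      omega
    · have h5 := hq (i - j) (by omega) (by omega) (-l)
      rw [Nat.cast_sub hij.le] at h5
      push_cast at h5
      exact absurd h5 (not_lt.2 (abs_le.2 ⟨by linarith, by linarith⟩))
  rw [logDerivSum, logDerivSum, ← Finset.sum_sub_distrib]
  refine (Finset.abs_sum_le_sum_abs _ _).trans ?_
  calc ∑ j ∈ Finset.range q, |Real.log (deriv F (F^[j] u)) - Real.log (deriv F (F^[j] v))|
      ≤ ∑ j ∈ Finset.range q, V * (F^[j] y - F^[j] x) := by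
        refine Finset.sum_le_sum fun j _ => (hlip _ _).trans (mul_le_mul_of_nonneg_left ?_ hV)
        have m := (hF.strictMono_iterate j).monotone
        rw [abs_le]
        constructor <;> linarith [m hu.1, m hu.2, m hv.1, m hv.2]
    _ ≤ V := by
        rw [← Finset.mul_sum]
        exact mul_le_of_le_one_right hV hsum

/-- **Denjoy's theorem**: if the logarithm of the derivative is Lipschitz, there is no wandering
interval. -/
theorem IsC1Diffeo.strictMono_of_lipschitz_log_deriv (hF : F.IsC1Diffeo) (hα : Irrational α)
    (hπ : IsRotationSemiconj α F π) {V : ℝ} (hV : 0 ≤ V)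
    (hlip : ∀ a b, |Real.log (deriv F a) - Real.log (deriv F b)| ≤ V * |a - b|) :
    StrictMono π := by
  rw [strictMono_iff_injective]
  by_contra hinj
  obtain ⟨A, B, hAB, hπAB⟩ : ∃ A B, A < B ∧ π A = π B := by
    simp only [Function.Injective, not_forall] at hinj
    obtain ⟨a, b, h1, h2⟩ := hinj
    rcases lt_or_gt_of_ne h2 with h | h
    exacts [⟨a, b, h, h1⟩, ⟨b, a, h, h1.symm⟩]
  obtain ⟨E, rfl⟩ := hF.isUnit
  set pw : ℤ → CircleDeg1Lift := fun m => ((E ^ m : CircleDeg1Liftˣ) : CircleDeg1Lift) with hpw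
  have hpwmono : ∀ m, StrictMono (pw m) := fun m => (toOrderIso (E ^ m)).strictMono
  have hpwnat : ∀ q : ℕ, pw q = ((E : CircleDeg1Lift) ^ q) := fun q => by
    simp [hpw]
  set len : ℤ → ℝ := fun m => pw m B - pw m A with hlen
  have hlen0 : ∀ m, 0 < len m := fun m => sub_pos.2 (hpwmono m hAB)
  -- `π` collapses each iterate of the arc to a point, and these points are distinct modulo `1`; so
  -- the lengths are summable.
  have hsum : ∀ s : Finset ℤ, ∑ m ∈ s, len m ≤ 1 := by
    intro s
    refine sum_length_le_one_of_disjoint_mod_one s _ _ (fun m _ => hpwmono m hAB) ?_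
    intro i _ j _ l u h1 h2 h3 h4
    have p1 := π.monotone h1
    have p2 := π.monotone h2.le
    have p3 := π.monotone h3
    have p4 := π.monotone h4.le
    simp only [hpw, hπ.map_zpow, map_add_int, hπAB] at p1 p2 p3 p4
    have h5 : ((j - i : ℤ) : ℝ) * α = (l : ℤ) := by push_cast; linarith
    have h6 : j - i = 0 := by
      by_contra hne
      exact (hα.intCast_mul hne).ne_int l h5
    rw [h6] at h5
    refine ⟨by omega, ?_⟩
    have : ((l : ℤ) : ℝ) = 0 := by rw [← h5]; simp
    exact_mod_cast this
  have hle1 : ∀ m, len m ≤ 1 := fun m => by simpa using hsum {m}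
  have hsummable : Summable fun q : ℕ => len q := by
    refine summable_of_sum_le (c := 1) (fun q => (hlen0 q).le) fun s => ?_
    have := hsum (s.map Nat.castEmbedding)
    simpa using this
  have hlim := hsummable.tendsto_atTop_zero
  have hc : 0 < len 0 * len 0 * Real.exp (-V) := by
    have := hlen0 0
    positivity
  obtain ⟨Q, hQ⟩ := Filter.eventually_atTop.1 (hlim.eventually (gt_mem_nhds hc))
  obtain ⟨q, hqQ, p, hp1, hq⟩ := hα.exists_closest_return Q
  have hlenq := hQ q hqQ.le
  have hqback : ∀ t, pw q (pw (-q) t) = t := fun t => by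
    simp only [hpw]
    rw [← mul_apply, ← Units.val_mul, ← zpow_add, add_neg_cancel, zpow_zero]; rfl
  -- The wandering arc and its `q`-th preimage lie in an interval of `π`-length at most `|qα - p|`,
  -- where `F^[q]` has distortion at most `V`. But the preimage is mapped with mean derivative at
  -- least `len 0`, and the arc with mean derivative `len q / len 0`, which is too small.
  set A' := pw (-q) A + p with hA'
  set B' := pw (-q) B + p with hB'
  have hAB' : A' < B' := add_lt_add_left (hpwmono _ hAB) _
  have hit : ∀ t, (E : CircleDeg1Lift)^[q] t = pw q t := fun t => by rw [hpwnat, coe_pow]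
  have hπA' : π A' = π A - (q * α - p) := by
    simp only [hA', map_add_int, hpw, hπ.map_zpow]; push_cast; ring
  have hπB' : π B' = π A - (q * α - p) := by
    simp only [hB', map_add_int, hpw, hπ.map_zpow, hπAB]; push_cast; ring
  have hmv : ∀ a b, a < b → ∃ u ∈ Set.Ioo a b,
      Real.exp (logDerivSum (E : CircleDeg1Lift) q u) = (pw q b - pw q a) / (b - a) := by
    intro a b hab
    obtain ⟨u, hu, h⟩ := exists_hasDerivAt_eq_slope (E : CircleDeg1Lift)^[q] _ hab
      (hF.continuous_iterate q).continuousOn fun u _ => hF.hasDerivAt_iterate q u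
    exact ⟨u, hu, by rw [h, hit, hit]⟩
  obtain ⟨v, hv, hv'⟩ := hmv A B hAB
  obtain ⟨u, hu, hu'⟩ := hmv A' B' hAB'
  have hulen : Real.exp (logDerivSum (E : CircleDeg1Lift) q u) = len 0 / len (-q) := by
    rw [hu', hA', hB', map_add_int, map_add_int, hqback, hqback]
    simp [hlen, hpw]
  have hvlen : Real.exp (logDerivSum (E : CircleDeg1Lift) q v) = len q / len 0 := by
    rw [hv']; simp [hlen, hpw]
  have hxy : |logDerivSum (E : CircleDeg1Lift) q u - logDerivSum (E : CircleDeg1Lift) q v| ≤ V := by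
    refine hF.abs_logDerivSum_sub_le hπ hV hlip (x := min A A') (y := max B B') hp1 hq
      ((min_le_left _ _).trans_lt (hAB.trans_le (le_max_left _ _))) ?_
      ⟨(min_le_right _ _).trans hu.1.le, hu.2.le.trans (le_max_right _ _)⟩
      ⟨(min_le_left _ _).trans hv.1.le, hv.2.le.trans (le_max_left _ _)⟩
    rcases min_choice A A' with h1 | h1 <;> rcases max_choice B B' with h2 | h2 <;>
      rw [h1, h2] <;> simp only [← hπAB, hπA', hπB']
    · rw [sub_self]; exact abs_nonneg _
    · linarith [neg_le_abs ((q : ℝ) * α - p)]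
    · linarith [le_abs_self ((q : ℝ) * α - p)]
    · rw [sub_self]; exact abs_nonneg _
  have hle := (abs_le.1 hxy).2
  have h3 : Real.exp (logDerivSum (E : CircleDeg1Lift) q u) ≤
      Real.exp V * Real.exp (logDerivSum (E : CircleDeg1Lift) q v) := by
    rw [← Real.exp_add]; exact Real.exp_le_exp.2 (by linarith)
  rw [hulen, hvlen, div_le_iff₀ (hlen0 _)] at h3
  have h0 := hlen0 0
  have h4 : len 0 ≤ Real.exp V * (len q / len 0) := by
    refine h3.trans (mul_le_of_le_one_right ?_ (hle1 _))
    have := hlen0 q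
    positivity
  rw [← mul_div_assoc, le_div_iff₀ h0] at h4
  rw [Real.exp_neg, ← div_eq_mul_inv, lt_div_iff₀ (Real.exp_pos V)] at hlenq
  linarith

end CircleDeg1Lift

/-! ### Smoothing -/

namespace CircleDeg1Lift

theorem exists_abs_sub_lt {f : CircleDeg1Lift} (hf : Continuous f) {ε : ℝ} (hε : 0 < ε) :
    ∃ η > 0, ∀ a b, |a - b| < η → |f a - f b| < ε := by
  have hp : Function.Periodic (fun t => f t - t) 1 := fun t => by
    simp only [map_add_one]; ring
  obtain ⟨η, hη, h⟩ := hp.exists_abs_sub_lt (hf.sub continuous_id) (half_pos hε)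
  refine ⟨min η (ε / 2), by positivity, fun a b hab => ?_⟩
  have h1 := abs_lt.1 (h a b (hab.trans_le (min_le_left _ _)))
  have h2 := abs_lt.1 (hab.trans_le (min_le_right _ _))
  rw [abs_lt]; constructor <;> linarith

/-- The running averages of a homeomorphism form a diffeomorphism. -/
theorem exists_smoothing {f : CircleDeg1Lift} (hf : Continuous f) (hmono : StrictMono f) {η : ℝ}
    (hη : 0 < η) :
    ∃ F : CircleDeg1Lift, F.IsC1Diffeo ∧ (∀ t, deriv F t = (f (t + η) - f t) / η) ∧
      ∀ t, f t ≤ F t ∧ F t ≤ f (t + η) := by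
  have hi : ∀ a b, IntervalIntegrable f MeasureTheory.volume a b := hf.intervalIntegrable
  set g : ℝ → ℝ := fun t => (∫ s in t..t + η, f s) / η with hg
  have hder : ∀ t, HasDerivAt g ((f (t + η) - f t) / η) t := by
    intro t
    have h1 : ∀ t, HasDerivAt (fun t => ∫ s in (0 : ℝ)..t, f s) (f t) t := fun t =>
      (hf.integral_hasStrictDerivAt 0 t).hasDerivAt
    have h2 : g = fun t => ((∫ s in (0 : ℝ)..t + η, f s) - ∫ s in (0 : ℝ)..t, f s) / η := by
      funext t
      rw [hg]
      simp only
      rw [intervalIntegral.integral_interval_sub_left (hi _ _) (hi _ _)]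
    rw [h2]
    exact ((h1 (t + η)).comp_add_const t η |>.sub (h1 t)).div_const η
  have hpos : ∀ t, 0 < (f (t + η) - f t) / η := fun t =>
    div_pos (sub_pos.2 (hmono (by linarith))) hη
  have hgm : StrictMono g := strictMono_of_deriv_pos fun t => by rw [(hder t).deriv]; exact hpos t
  have hadd : ∀ t, g (t + 1) = g t + 1 := by
    intro t
    have h1 : ∫ s in t + 1..t + 1 + η, f s = ∫ s in t..t + η, (f s + 1) := by
      simp only [← map_add_one]
      rw [intervalIntegral.integral_comp_add_right (fun s => f s) 1]
      congr 1; ring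
    have h2 : ∫ s in t..t + η, (f s + 1) = (∫ s in t..t + η, f s) + η := by
      rw [intervalIntegral.integral_add (hi _ _) intervalIntegrable_const]; simp
    simp only [hg, h1, h2]
    field_simp
  let F : CircleDeg1Lift := ⟨⟨g, hgm.monotone⟩, hadd⟩
  have hF : ∀ t, HasDerivAt F ((f (t + η) - f t) / η) t := hder
  refine ⟨F, IsC1Diffeo.of_hasDerivAt hF (by fun_prop) hpos, fun t => (hF t).deriv, fun t => ?_⟩
  have hle : t ≤ t + η := by linarith
  constructor
  · change f t ≤ (∫ s in t..t + η, f s) / η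
    rw [le_div_iff₀ hη]
    have := intervalIntegral.integral_mono_on (f := fun _ => f t) hle intervalIntegrable_const
      (hi t (t + η)) fun s hs => hmono.monotone hs.1
    simpa [mul_comm] using this
  · change (∫ s in t..t + η, f s) / η ≤ f (t + η)
    rw [div_le_iff₀ hη]
    have := intervalIntegral.integral_mono_on (g := fun _ => f (t + η)) hle (hi t (t + η))
      intervalIntegrable_const fun s hs => hmono.monotone hs.2
    simpa [mul_comm] using this

/-- The translate `c + F`. -/
noncomputable def addConst (c : ℝ) (F : CircleDeg1Lift) : CircleDeg1Lift :=
  (translate (Multiplicative.ofAdd c) : CircleDeg1Lift) * F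

@[simp]
theorem addConst_apply (c : ℝ) (F : CircleDeg1Lift) (t : ℝ) : addConst c F t = c + F t := by
  simp [addConst]

theorem deriv_addConst (c : ℝ) (F : CircleDeg1Lift) : deriv (addConst c F) = deriv F := by
  have : ⇑(addConst c F) = fun t => c + F t := funext (addConst_apply c F)
  exact funext fun t => by rw [this, deriv_const_add]

theorem IsC1Diffeo.addConst {F : CircleDeg1Lift} (hF : F.IsC1Diffeo) (c : ℝ) :
    (addConst c F).IsC1Diffeo := by
  refine of_hasDerivAt (F' := deriv F) (fun t => ?_) hF.continuous_deriv hF.deriv_pos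
  have : ⇑(CircleDeg1Lift.addConst c F) = fun t => c + F t := funext (addConst_apply c F)
  rw [this]
  exact (hF.hasDerivAt t).const_add c

/-- The translation number is approximated by `(addConst c F ^ n) 0 / n`, continuous in `c`, with an
error at most `1 / n` uniformly in `c`. -/
theorem continuous_translationNumber_addConst {F : CircleDeg1Lift} (hF : Continuous F) :
    Continuous fun c => (addConst c F).translationNumber := by
  have hiter : ∀ n : ℕ, Continuous fun c => (addConst c F ^ n) 0 := by
    intro n
    induction n with
    | zero => simpa using continuous_const
    | succ n ih =>
      simp only [pow_succ', mul_apply, addConst_apply]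
      exact continuous_id.add (hF.comp ih)
  refine continuous_of_uniform_approx_of_continuous fun u hu => ?_
  obtain ⟨ε, hε, hεu⟩ := Metric.mem_uniformity_dist.1 hu
  obtain ⟨n, hn⟩ := exists_nat_gt (1 / ε)
  have hn0 : (0 : ℝ) < n := lt_trans (by positivity) hn
  refine ⟨fun c => (addConst c F ^ n) 0 / n, (hiter n).div_const _, fun c => hεu ?_⟩
  have h := dist_pow_map_zero_mul_translationNumber_le (addConst c F) n
  rw [dist_comm, Real.dist_eq] at h ⊢
  have h2 : (addConst c F ^ n) 0 / n - translationNumber (addConst c F) =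
      -((n * translationNumber (addConst c F) - (addConst c F ^ n) 0) / n) := by
    field_simp; ring
  rw [h2, abs_neg, abs_div, abs_of_pos hn0, div_lt_iff₀ hn0]
  rw [div_lt_iff₀ hε] at hn
  linarith

/-- A circle diffeomorphism is `C¹`-close to one with Lipschitz derivative and the same translation
number. -/
theorem IsC1Diffeo.exists_close_lipschitz {G : CircleDeg1Lift} (hG : G.IsC1Diffeo) {ε : ℝ}
    (hε : 0 < ε) :
    ∃ H : CircleDeg1Lift, H.IsC1Diffeo ∧ H.translationNumber = G.translationNumber ∧
      (∃ V ≥ 0, ∀ a b, |Real.log (deriv H a) - Real.log (deriv H b)| ≤ V * |a - b|) ∧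
      (∀ t, |H t - G t| ≤ ε) ∧ ∀ t, |deriv H t - deriv G t| ≤ ε := by
  obtain ⟨η₁, hη₁, hu₁⟩ := exists_abs_sub_lt hG.continuous hε
  obtain ⟨η₂, hη₂, hu₂⟩ := (show Function.Periodic (deriv G) 1 from
    deriv_add_one G).exists_abs_sub_lt hG.continuous_deriv hε
  obtain ⟨B, hB, hGB⟩ := (show Function.Periodic (deriv G) 1 from
    deriv_add_one G).exists_abs_le hG.continuous_deriv
  set η := min η₁ η₂ / 2 with hη
  have hη0 : 0 < η := by positivity
  have hηlt : η < min η₁ η₂ := half_lt_self (by positivity)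
  obtain ⟨S, hS, hSd, hSb⟩ := exists_smoothing hG.continuous hG.strictMono hη0
  have hshift : ∀ t, G (t + η) ≤ G t + ε := fun t => by
    have := abs_lt.1 (hu₁ (t + η) t (by
      rw [add_sub_cancel_left, abs_of_pos hη0]; exact hηlt.trans_le (min_le_left _ _)))
    linarith
  have hle1 : (CircleDeg1Lift.addConst (-ε) S).translationNumber ≤ G.translationNumber :=
    translationNumber_mono fun t => by
      rw [addConst_apply]; linarith [hshift t, (hSb t).2]
  have hle2 : G.translationNumber ≤ (CircleDeg1Lift.addConst 0 S).translationNumber :=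
    translationNumber_mono fun t => by
      rw [addConst_apply]; linarith [(hSb t).1]
  -- Averaging moves `G` up by at most `ε`, so lowering by some `c ∈ [-ε, 0]` restores the
  -- translation number.
  obtain ⟨c, ⟨hc1, hc2⟩, hc⟩ := intermediate_value_Icc (show -ε ≤ 0 by linarith)
    (continuous_translationNumber_addConst hS.continuous).continuousOn ⟨hle1, hle2⟩
  have hH := hS.addConst c
  obtain ⟨m, hm, hmin⟩ := (show Function.Periodic (deriv S) 1 from
    deriv_add_one S).exists_pos_le hS.continuous_deriv hS.deriv_pos
  have hGlip : ∀ a b, |G a - G b| ≤ B * |a - b| := by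
    intro a b
    have := Convex.norm_image_sub_le_of_norm_deriv_le (f := G) (C := B) (s := Set.univ) (x := b)
      (y := a) (fun t _ => hG.differentiable t) (fun t _ => hGB t) convex_univ trivial trivial
    simpa [Real.norm_eq_abs] using this
  refine ⟨CircleDeg1Lift.addConst c S, hH, hc, ⟨2 * B / η / m, by positivity, fun a b => ?_⟩,
    fun t => ?_, fun t => ?_⟩
  · rw [deriv_addConst]
    have h1 : ∀ x y : ℝ, m ≤ x → m ≤ y → Real.log x - Real.log y ≤ |x - y| / m := by
      intro x y hx hy
      have hx0 := hm.trans_le hx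
      have hy0 := hm.trans_le hy
      rw [← Real.log_div hx0.ne' hy0.ne']
      refine (Real.log_le_sub_one_of_pos (div_pos hx0 hy0)).trans ?_
      rw [div_sub_one hy0.ne']
      exact (div_le_div_of_nonneg_right (le_abs_self _) hy0.le).trans
        (div_le_div_of_nonneg_left (abs_nonneg _) hm hy)
    have h2 : |deriv S a - deriv S b| ≤ 2 * B / η * |a - b| := by
      rw [hSd, hSd, ← sub_div, abs_div, abs_of_pos hη0, div_le_iff₀ hη0]
      have e : 2 * B / η * |a - b| * η = B * |a - b| + B * |a - b| := by
        field_simp; ring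
      have h3 := hGlip (a + η) (b + η)
      rw [add_sub_add_right_eq_sub] at h3
      have h4 := hGlip a b
      rw [e]
      have h5 : G (a + η) - G a - (G (b + η) - G b) = (G (a + η) - G (b + η)) - (G a - G b) := by
        ring
      rw [h5]
      exact (abs_sub _ _).trans (add_le_add h3 h4)
    have h3 : |deriv S a - deriv S b| / m ≤ 2 * B / η / m * |a - b| := by
      rw [div_mul_eq_mul_div _ m]
      exact div_le_div_of_nonneg_right h2 hm.le
    rw [abs_le]
    constructor
    · have := h1 _ _ (hmin b) (hmin a)
      rw [abs_sub_comm] at this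
      linarith
    · exact (h1 _ _ (hmin a) (hmin b)).trans h3
  · rw [addConst_apply, abs_le]
    constructor <;> linarith [hshift t, (hSb t).1, (hSb t).2]
  · rw [deriv_addConst, hSd]
    obtain ⟨ξ, hξ, hξ'⟩ := exists_hasDerivAt_eq_slope G (deriv G) (show t < t + η by linarith)
      hG.continuous.continuousOn fun u _ => hG.hasDerivAt u
    rw [add_sub_cancel_left] at hξ'
    rw [← hξ']
    refine (hu₂ ξ t ?_).le
    rw [abs_of_pos (by linarith [hξ.1])]
    linarith [hξ.2, min_le_right η₁ η₂]

end CircleDeg1Lift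

/-! ### Approximate conjugacies from a rotation -/

namespace CircleDeg1Lift

theorem surjective_of_continuous {f : CircleDeg1Lift} (hf : Continuous f) :
    Function.Surjective f :=
  hf.surjective f.tendsto_atTop f.tendsto_atBot

/-- There is a diffeomorphism that nearly conjugates the rotation to a given one, in the `C¹`
sense. -/
theorem IsC1Diffeo.exists_approx_conj {G : CircleDeg1Lift} (hG : G.IsC1Diffeo) {α : ℝ}
    (hα : Irrational α) (hGα : G.translationNumber = α) {ε : ℝ} (hε : 0 < ε) :
    ∃ ψ : CircleDeg1Lift, ψ.IsC1Diffeo ∧ (∀ t, |ψ (t + α) - G (ψ t)| ≤ ε) ∧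
      ∀ t, |deriv ψ (t + α) / deriv ψ t - deriv G (ψ t)| ≤ ε := by
  obtain ⟨H, hH, hHα, ⟨V, hV, hlip⟩, hHG, hHG'⟩ := hG.exists_close_lipschitz (half_pos hε)
  rw [hGα] at hHα
  obtain ⟨π, hπ⟩ := hH.exists_isRotationSemiconj (by rwa [hHα])
  rw [hHα] at hπ
  have hmono := hH.strictMono_of_lipschitz_log_deriv hα hπ hV hlip
  obtain ⟨E, rfl⟩ : IsUnit π :=
    isUnit_iff_bijective.2 ⟨hmono.injective, surjective_of_continuous hπ.continuous⟩
  -- The inverse of `π` conjugates the rotation to `H` exactly, but is only a homeomorphism; `ψ`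
  -- will be its running average.
  set ψ₀ : CircleDeg1Lift := ((E⁻¹ : CircleDeg1Liftˣ) : CircleDeg1Lift) with hψ₀
  have hleft : ∀ t, ψ₀ ((E : CircleDeg1Lift) t) = t := fun t => units_inv_apply_apply E t
  have hright : ∀ t, (E : CircleDeg1Lift) (ψ₀ t) = t := fun t => units_apply_inv_apply E t
  have hcont : Continuous ψ₀ := continuous_units _
  have hψmono : StrictMono ψ₀ := fun a b hab => by
    by_contra! h
    have := hmono.monotone h
    rw [hright, hright] at this
    linarith
  have hconj : ∀ t, ψ₀ (t + α) = H (ψ₀ t) := fun t => by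
    rw [← hleft (H (ψ₀ t)), hπ.map, hright]
  obtain ⟨η₁, hη₁, hu₁⟩ := (show Function.Periodic (deriv H) 1 from
    deriv_add_one H).exists_abs_sub_lt hH.continuous_deriv (half_pos hε)
  obtain ⟨η₂, hη₂, hu₂⟩ := exists_abs_sub_lt hcont (lt_min (half_pos hε) hη₁)
  obtain ⟨ψ, hψ, hψd, hψb⟩ := exists_smoothing hcont hψmono (half_pos hη₂)
  have hη0 := half_pos hη₂
  have hstep : ∀ t, ψ₀ (t + η₂ / 2) - ψ₀ t < min (ε / 2) η₁ := fun t =>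
    (le_abs_self _).trans_lt (hu₂ _ _ (by
      rw [add_sub_cancel_left, abs_of_pos hη0]; linarith))
  refine ⟨ψ, hψ, fun t => ?_, fun t => ?_⟩
  · have h1 := hψb (t + α)
    have h2 := hψb t
    have h3 := hH.strictMono.monotone h2.1
    have h4 := hH.strictMono.monotone h2.2
    rw [← hconj] at h3 h4
    rw [add_right_comm] at h4
    have h5 := (hstep (t + α)).trans_le (min_le_left _ _)
    have h6 := abs_le.1 (hHG (ψ t))
    rw [abs_le]
    constructor <;> linarith
  -- Both derivatives are increments of `ψ₀`; by the exact conjugacy their ratio is a difference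
  -- quotient of `H` over a short interval.
  · rw [hψd, hψd, div_div_div_cancel_right₀ hη0.ne', add_right_comm, hconj, hconj]
    have hlt : ψ₀ t < ψ₀ (t + η₂ / 2) := hψmono (by linarith)
    obtain ⟨ξ, hξ, hξ'⟩ := exists_hasDerivAt_eq_slope H (deriv H) hlt
      hH.continuous.continuousOn fun u _ => hH.hasDerivAt u
    rw [← hξ']
    have h1 := (hstep t).trans_le (min_le_right _ _)
    have h2 := abs_lt.1 (hu₁ ξ (ψ t) (by
      rw [abs_lt]; constructor <;> linarith [hξ.1, hξ.2, (hψb t).1, (hψb t).2]))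
    have h3 := abs_le.1 (hHG' (ψ t))
    rw [abs_le]
    constructor <;> linarith

/-- A small periodic perturbation which makes the identity constant near the half-integers. -/
theorem exists_flattening {δ : ℝ} (hδ : 0 < δ) :
    ∃ κ > 0, ∃ e : ℝ → ℝ, Continuous e ∧ Function.Periodic e 1 ∧ (∀ t, |e t| ≤ δ) ∧
      ∀ (t : ℝ) (l : ℤ), |2 * t - l| ≤ κ → e t = t - l / 2 := by
  set κ := min (1 / 4) (2 * δ) with hκ
  have hκ0 : 0 < κ := by positivity
  -- A triangle wave equal to `2t - l` for `|2t - l| ≤ 1/4`; the shift by `1/4` keeps its corners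
  -- away from the half-integers.
  set w : ℝ → ℝ := fun t => 1 / 4 - ‖((2 * t - 1 / 4 : ℝ) : UnitAddCircle)‖ with hw
  refine ⟨κ, hκ0, fun t => max (-κ) (min κ (w t)) / 2, ?_, ?_, ?_, ?_⟩
  · have : Continuous w := continuous_const.sub
      ((AddCircle.continuous_mk' (1 : ℝ)).comp (by fun_prop : Continuous fun t : ℝ =>
        2 * t - 1 / 4)).norm
    fun_prop
  · intro t
    have : w (t + 1) = w t := by
      simp only [hw]
      have e : 2 * (t + 1) - 1 / 4 = (2 * t - 1 / 4) + (2 : ℤ) • (1 : ℝ) := by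
        push_cast [zsmul_eq_mul]; ring
      rw [e, AddCircle.coe_add, AddCircle.coe_zsmul, AddCircle.coe_period, smul_zero, add_zero]
    simp only [this]
  · intro t
    have h1 : κ ≤ 2 * δ := min_le_right _ _
    have h2 : max (-κ) (min κ (w t)) ≤ κ := max_le (by linarith) (min_le_left _ _)
    have h3 : -κ ≤ max (-κ) (min κ (w t)) := le_max_left _ _
    rw [abs_le]
    constructor <;> linarith
  · intro t l h
    have h0 : κ ≤ 1 / 4 := min_le_left _ _
    have h' := abs_le.1 h
    have h1 : w t = 2 * t - l := by
      have e : 2 * t - 1 / 4 = (2 * t - l - 1 / 4) + (l : ℤ) • (1 : ℝ) := by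
        push_cast [zsmul_eq_mul]; ring
      have hneg : 2 * t - l - 1 / 4 ≤ 0 := by linarith
      simp only [hw]
      rw [e, AddCircle.coe_add, AddCircle.coe_zsmul, AddCircle.coe_period, smul_zero, add_zero,
        (AddCircle.norm_coe_eq_abs_iff (1 : ℝ) one_ne_zero).2, abs_of_nonpos hneg]
      · ring
      · rw [abs_one, abs_le]; constructor <;> linarith
    simp only [h1, min_eq_right h'.2, max_eq_right h'.1]
    ring

/-- A diffeomorphism can be perturbed so that it becomes affine near the half-integers. -/
theorem IsC1Diffeo.exists_close_locally_affine {ψ₁ : CircleDeg1Lift} (h₁ : ψ₁.IsC1Diffeo)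
    {ν : ℝ} (hν : 0 < ν) (t₁ : ℝ) :
    ∃ κ > 0, ∃ ψ : CircleDeg1Lift, ψ.IsC1Diffeo ∧ ψ 0 = ψ₁ t₁ ∧
      (∀ (s t : ℝ) (l : ℤ), |2 * s - l| ≤ κ → |2 * t - l| ≤ κ → deriv ψ s = deriv ψ t) ∧
      (∀ t, |ψ t - ψ₁ (t + t₁)| ≤ ν) ∧ ∀ t, |deriv ψ t - deriv ψ₁ (t + t₁)| ≤ ν := by
  have hper : Function.Periodic (deriv ψ₁) 1 := deriv_add_one ψ₁
  obtain ⟨B, hB, hbd⟩ := hper.exists_abs_le h₁.continuous_deriv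
  set ν₁ := min (1 / 2) (ν / (1 + 2 * B)) with hν₁
  have hν₁0 : 0 < ν₁ := by positivity
  have hν₁2 : ν₁ * (1 + 2 * B) ≤ ν := by
    rw [← le_div_iff₀ (by positivity)]; exact min_le_right _ _
  have hν₁h : ν₁ ≤ 1 / 2 := min_le_left _ _
  obtain ⟨η, hη, hu⟩ := hper.exists_abs_sub_lt h₁.continuous_deriv hν₁0
  obtain ⟨κ, hκ, e, hec, hep, heb, hel⟩ := exists_flattening (half_pos hη)
  -- Near `l / 2` the argument `t - e t` is constantly `l / 2`, so `D` is constant there. Its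
  -- integral `Z` over a period is close to `1`, so normalizing changes it little.
  set D : ℝ → ℝ := fun t => deriv ψ₁ (t - e t + t₁) with hD
  have hDc : Continuous D := h₁.continuous_deriv.comp (by fun_prop)
  have hDp : Function.Periodic D 1 := fun t => by
    simp only [hD, hep t]
    rw [← hper (t - e t + t₁)]; congr 1; ring
  have hDu : ∀ t, |D t - deriv ψ₁ (t + t₁)| ≤ ν₁ := fun t => by
    refine (hu _ _ ?_).le
    have : t - e t + t₁ - (t + t₁) = -e t := by ring
    rw [this, abs_neg]
    linarith [heb t]
  obtain ⟨ψ, hψ, hψ0, Z, hZ, hψd⟩ := exists_deriv_eq_div hDc hDp (fun t => h₁.deriv_pos _) 0 (ψ₁ t₁)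
  have hZ' : Z = ∫ s in (0 : ℝ)..1, D s := (hψd 0).2
  have hZ1 : |Z - 1| ≤ ν₁ := by
    have hi : ∫ s in (0 : ℝ)..1, deriv ψ₁ (s + t₁) = 1 := by
      rw [intervalIntegral.integral_comp_add_right (fun s => deriv ψ₁ s) t₁,
        intervalIntegral.integral_deriv_eq_sub (fun t _ => h₁.differentiable t)
          (h₁.continuous_deriv.intervalIntegrable _ _), zero_add, add_comm, map_add_one]
      ring
    have hc2 : Continuous fun s => deriv ψ₁ (s + t₁) := h₁.continuous_deriv.comp (by fun_prop)
    have h2 : Z - 1 = ∫ s in (0 : ℝ)..1, (D s - deriv ψ₁ (s + t₁)) := by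
      rw [intervalIntegral.integral_sub (hDc.intervalIntegrable _ _)
        (hc2.intervalIntegrable _ _), hi, hZ']
    rw [h2, ← Real.norm_eq_abs]
    simpa using intervalIntegral.norm_integral_le_of_norm_le_const (a := (0 : ℝ)) (b := 1)
      (C := ν₁) (f := fun s => D s - deriv ψ₁ (s + t₁)) fun s _ => hDu s
  have hZh := abs_le.1 hZ1
  have hder : ∀ t, |deriv ψ t - deriv ψ₁ (t + t₁)| ≤ ν := by
    intro t
    have hDB : D t ≤ B := (le_abs_self _).trans (hbd _)
    have hD0 : 0 < D t := h₁.deriv_pos _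
    have h1 : |D t / Z - D t| ≤ 2 * B * ν₁ := by
      have : D t / Z - D t = -(D t * (Z - 1)) / Z := by field_simp; ring
      rw [this, abs_div, abs_neg, abs_mul, abs_of_pos hD0, abs_of_pos hZ, div_le_iff₀ hZ]
      calc D t * |Z - 1| ≤ B * ν₁ := by gcongr
        _ = 2 * B * ν₁ * (1 / 2) := by ring
        _ ≤ 2 * B * ν₁ * Z := by gcongr; linarith
    rw [(hψd t).1]
    have h2 := abs_le.1 (hDu t)
    have h3 := abs_le.1 h1
    rw [abs_le]
    constructor <;> linarith
  refine ⟨κ, hκ, ψ, hψ, hψ0, fun s t l hs ht => ?_, fun t => ?_, hder⟩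
  · rw [(hψd s).1, (hψd t).1]
    simp only [hD, hel s l hs, hel t l ht]
    ring_nf
  · have hp : Function.Periodic (fun t => ψ t - ψ₁ (t + t₁)) 1 := fun t => by
      simp only
      rw [add_right_comm, map_add_one, map_add_one]; ring
    obtain ⟨s, hs, hst⟩ := hp.exists_mem_Ico₀ one_pos t
    rw [hst]
    have hd : ∀ u, HasDerivAt (fun t => ψ t - ψ₁ (t + t₁)) (deriv ψ u - deriv ψ₁ (u + t₁)) u :=
      fun u => (hψ.hasDerivAt u).sub ((h₁.hasDerivAt (u + t₁)).comp_add_const u t₁)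
    have := Convex.norm_image_sub_le_of_norm_hasDerivWithin_le (s := Set.univ) (C := ν) (x := 0)
      (y := s) (fun u _ => (hd u).hasDerivWithinAt) (fun u _ => hder u) convex_univ trivial trivial
    simp only [hψ0, zero_add, sub_self, sub_zero, Real.norm_eq_abs, abs_of_nonneg hs.1] at this
    exact this.trans (by nlinarith [hs.2])

theorem _root_.abs_div_sub_div_le {a b a' b' m B ν : ℝ} (hm : 0 < m) (hb : m ≤ b)
    (hν : ν ≤ m / 2) (ha : |a| ≤ B) (haa : |a' - a| ≤ ν) (hbb : |b' - b| ≤ ν) :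
    |a' / b' - a / b| ≤ (2 / m + 2 * B / m ^ 2) * ν := by
  have hbb' := abs_le.1 hbb
  have hb0 : 0 < b := hm.trans_le hb
  have hb1 : m / 2 ≤ b' := by linarith
  have hb'0 : 0 < b' := by linarith
  have hB : 0 ≤ B := (abs_nonneg _).trans ha
  have hν0 : 0 ≤ ν := (abs_nonneg _).trans haa
  have e : a' / b' - a / b = (a' - a) / b' + a * (b - b') / (b' * b) := by field_simp; ring
  rw [e]
  refine (abs_add_le _ _).trans ?_
  rw [abs_div, abs_div, abs_mul, abs_of_pos hb'0, abs_of_pos (mul_pos hb'0 hb0), abs_sub_comm b]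
  have h1 : |a' - a| / b' ≤ ν / (m / 2) := by gcongr
  have h2 : |a| * |b' - b| / (b' * b) ≤ B * ν / (m / 2 * m) := by gcongr
  refine (add_le_add h1 h2).trans (le_of_eq ?_)
  field_simp

/-- The approximate conjugacy can be chosen affine near the half-integers, with a prescribed value
at the origin. -/
theorem IsC1Diffeo.exists_approx_conj_locally_affine {G : CircleDeg1Lift} (hG : G.IsC1Diffeo)
    {α : ℝ} (hα : Irrational α) (hGα : G.translationNumber = α) (y₀ : ℝ) {ε : ℝ} (hε : 0 < ε) :
    ∃ κ > 0, ∃ ψ : CircleDeg1Lift, ψ.IsC1Diffeo ∧ ψ 0 = y₀ ∧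
      (∀ (s t : ℝ) (l : ℤ), |2 * s - l| ≤ κ → |2 * t - l| ≤ κ → deriv ψ s = deriv ψ t) ∧
      (∀ t, |ψ (t + α) - G (ψ t)| ≤ ε) ∧
      ∀ t, |deriv ψ (t + α) / deriv ψ t - deriv G (ψ t)| ≤ ε := by
  have hε3 : 0 < ε / 3 := by positivity
  obtain ⟨ψ₁, h₁, hψ₁, hψ₁'⟩ := hG.exists_approx_conj hα hGα hε3
  -- Translations commute with the rotation, so `ψ₁ (· + t₁)` is an equally good approximate
  -- conjugacy, and it takes the value `y₀` at `0`.
  obtain ⟨t₁, ht₁⟩ := h₁.surjective y₀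
  obtain ⟨η₁, hη₁, hu₁⟩ := exists_abs_sub_lt hG.continuous hε3
  obtain ⟨η₂, hη₂, hu₂⟩ := (show Function.Periodic (deriv G) 1 from
    deriv_add_one G).exists_abs_sub_lt hG.continuous_deriv hε3
  have hper : Function.Periodic (deriv ψ₁) 1 := deriv_add_one ψ₁
  obtain ⟨B, hB, hbd⟩ := hper.exists_abs_le h₁.continuous_deriv
  obtain ⟨m, hm, hmin⟩ := hper.exists_pos_le h₁.continuous_deriv h₁.deriv_pos
  set K := 2 / m + 2 * B / m ^ 2 with hK
  have hK0 : 0 < K := by positivity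
  obtain ⟨ν, hν, hν'⟩ : ∃ ν > 0, ν < η₁ ∧ ν < η₂ ∧ ν ≤ m / 2 ∧ ν ≤ ε / 3 ∧ ν ≤ ε / 3 / K := by
    refine ⟨min (min (η₁ / 2) (η₂ / 2)) (min (m / 2) (min (ε / 3) (ε / 3 / K))), by positivity,
      ?_, ?_, ?_, ?_, ?_⟩
    · exact ((min_le_left _ _).trans (min_le_left _ _)).trans_lt (by linarith)
    · exact ((min_le_left _ _).trans (min_le_right _ _)).trans_lt (by linarith)
    · exact (min_le_right _ _).trans (min_le_left _ _)
    · exact (min_le_right _ _).trans ((min_le_right _ _).trans (min_le_left _ _))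
    · exact (min_le_right _ _).trans ((min_le_right _ _).trans (min_le_right _ _))
  obtain ⟨hνη₁, hνη₂, hνm, hνε, hνK⟩ := hν'
  rw [le_div_iff₀ hK0] at hνK
  obtain ⟨κ, hκ, ψ, hψ, hψ0, haff, hclose, hclose'⟩ := h₁.exists_close_locally_affine hν t₁
  refine ⟨κ, hκ, ψ, hψ, hψ0.trans ht₁, haff, fun t => ?_, fun t => ?_⟩
  · have h1 := abs_le.1 (hclose (t + α))
    rw [add_right_comm] at h1
    have h2 := abs_le.1 (hψ₁ (t + t₁))
    have h3 := abs_lt.1 (hu₁ _ _ ((hclose t).trans_lt hνη₁))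
    rw [abs_le]
    constructor <;> linarith
  · have h1 := hclose' (t + α)
    rw [add_right_comm] at h1
    have h2 := abs_le.1 (hψ₁' (t + t₁))
    have h3 := abs_lt.1 (hu₂ _ _ ((hclose t).trans_lt hνη₂))
    have h4 := abs_le.1 (abs_div_sub_div_le hm (hmin (t + t₁)) hνm (hbd (t + t₁ + α)) h1
      (hclose' t))
    rw [abs_le]
    constructor <;> linarith

end CircleDeg1Lift

/-! ### A conjugate of one diffeomorphism close to another one -/

namespace CircleDeg1Lift

theorem IsC1Diffeo.deriv_mul {F G : CircleDeg1Lift} (hF : F.IsC1Diffeo) (hG : G.IsC1Diffeo)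
    (t : ℝ) : deriv (F * G : CircleDeg1Lift) t = deriv F (G t) * deriv G t :=
  ((hF.hasDerivAt (G t)).comp t (hG.hasDerivAt t)).deriv

/-- Compose `P`, bringing `F` close to the rotation, with `ψ`, bringing the rotation close to `G`.
The precision `δ` of `P` is fixed after `ψ`, as it depends on the derivative bounds and moduli of
continuity of `ψ`. -/
theorem IsC1Diffeo.exists_locally_affine_conj_close {F G π : CircleDeg1Lift} {α : ℝ}
    (hF : F.IsC1Diffeo) (hG : G.IsC1Diffeo) (hα : Irrational α)
    (hπ : IsRotationSemiconj α F π) (hGα : G.translationNumber = α) (t₀ y₀ : ℝ) {ε : ℝ}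
    (hε : 0 < ε) :
    ∃ κ > 0, ∃ Φ : CircleDeg1Lift, Φ.IsC1Diffeo ∧ Φ t₀ = y₀ ∧
      (∀ (s t : ℝ) (l : ℤ), |2 * (π s - π t₀) - l| ≤ κ → |2 * (π t - π t₀) - l| ≤ κ →
        deriv Φ s = deriv Φ t) ∧
      (∀ t, |Φ (F t) - G (Φ t)| ≤ ε) ∧
      ∀ t, |deriv Φ (F t) * deriv F t / deriv Φ t - deriv G (Φ t)| ≤ ε := by
  obtain ⟨κ, hκ, ψ, hψ, hψ0, haff, hψG, hψG'⟩ :=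
    hG.exists_approx_conj_locally_affine hα hGα y₀ (show 0 < ε / 3 by positivity)
  have hper : Function.Periodic (deriv ψ) 1 := deriv_add_one ψ
  obtain ⟨B, hB, hbd⟩ := hper.exists_abs_le hψ.continuous_deriv
  obtain ⟨m, hm, hmin⟩ := hper.exists_pos_le hψ.continuous_deriv hψ.deriv_pos
  obtain ⟨η₁, hη₁, hu₁⟩ := exists_abs_sub_lt hψ.continuous (show 0 < ε / 3 by positivity)
  obtain ⟨η₂, hη₂, hu₂⟩ := hper.exists_abs_sub_lt hψ.continuous_deriv
    (show 0 < m * (ε / 3) by positivity)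
  obtain ⟨δ, hδ, hδ₁, hδ₂, hδ₃⟩ : ∃ δ > 0, δ < η₁ ∧ δ < η₂ ∧ δ ≤ ε / 3 / (B / m) := by
    refine ⟨min (min (η₁ / 2) (η₂ / 2)) (ε / 3 / (B / m)), by positivity, ?_, ?_, min_le_right _ _⟩
    · exact ((min_le_left _ _).trans (min_le_left _ _)).trans_lt (by linarith)
    · exact ((min_le_left _ _).trans (min_le_right _ _)).trans_lt (by linarith)
  rw [le_div_iff₀ (by positivity)] at hδ₃
  obtain ⟨κ', hκ', P, hP, hP0, hPF, hPF', c, hc, hPc⟩ :=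
    hF.exists_conj_close_to_rotation hα hπ t₀ hδ hκ
  have hΦ := hψ.mul hP
  refine ⟨κ', hκ', ψ * P, hΦ, ?_, fun s t l hs ht => ?_, fun t => ?_, fun t => ?_⟩
  · rw [mul_apply, hP0, hψ0]
  · rw [hψ.deriv_mul hP, hψ.deriv_mul hP, (hPc s l hs).1, (hPc t l ht).1,
      haff _ _ l (hPc s l hs).2 (hPc t l ht).2]
  · rw [mul_apply, mul_apply]
    have h1 := abs_lt.1 (hu₁ (P (F t)) (P t + α) (by
      rw [← sub_sub]; exact (hPF t).trans_lt hδ₁))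
    have h2 := abs_le.1 (hψG (P t))
    rw [abs_le]
    constructor <;> linarith
  · rw [hψ.deriv_mul hP, hψ.deriv_mul hP, mul_apply]
    have h1 := (hu₂ (P (F t)) (P t + α) (by
      rw [← sub_sub]; exact (hPF t).trans_lt hδ₂)).le
    have h2 := abs_le.1 (hψG' (P t))
    set b := deriv ψ (P t) with hb
    set a := deriv ψ (P (F t)) with ha
    set a' := deriv ψ (P t + α) with ha'
    set r := deriv P (F t) * deriv F t / deriv P t with hr
    have hb0 : 0 < b := hψ.deriv_pos _
    have hPt := (hP.deriv_pos t).ne'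
    have ha0 : 0 < a := hψ.deriv_pos _
    -- The first term measures the failure of the conjugate by `P` to have derivative `1`, the
    -- second the variation of `ψ'` between `P (F t)` and `P t + α`.
    have e : a * deriv P (F t) * deriv F t / (b * deriv P t) =
        a / b * (r - 1) + (a - a') / b + a' / b := by
      rw [hr]; field_simp; ring
    have h3 : |a / b * (r - 1)| ≤ ε / 3 := by
      rw [abs_mul, abs_of_pos (div_pos ha0 hb0)]
      calc a / b * |r - 1| ≤ B / m * δ := by
            gcongr
            · exact (le_abs_self _).trans (hbd _)
            · exact hmin _
            · exact hPF' t
        _ ≤ ε / 3 := by rw [mul_comm]; exact hδ₃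
    have h4 : |(a - a') / b| ≤ ε / 3 := by
      rw [abs_div, abs_of_pos hb0, div_le_iff₀ hb0]
      refine h1.trans ?_
      rw [mul_comm]
      gcongr
      exact hmin _
    rw [e]
    have h3' := abs_le.1 h3
    have h4' := abs_le.1 h4
    rw [abs_le]
    constructor <;> linarith

/-- Given two diffeomorphisms with the same irrational translation number, the first one has a
conjugate close to the second one, by a conjugacy which is affine near the point `t₀` and near the
point half a turn away from it. -/
theorem IsC1Diffeo.exists_conj_close {F G π : CircleDeg1Lift} {α : ℝ}
    (hF : F.IsC1Diffeo) (hG : G.IsC1Diffeo) (hα : Irrational α)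
    (hπ : IsRotationSemiconj α F π) (hFα : F.translationNumber = α)
    (hGα : G.translationNumber = α) (t₀ y₀ : ℝ) {ε : ℝ} (hε : 0 < ε) :
    ∃ κ > 0, ∃ Φ H : CircleDeg1Lift, Φ.IsC1Diffeo ∧ H.IsC1Diffeo ∧ Φ t₀ = y₀ ∧
      H.translationNumber = α ∧ (∀ t, H (Φ t) = Φ (F t)) ∧
      (∀ (s t : ℝ) (l : ℤ), |2 * (π s - π t₀) - l| ≤ κ → |2 * (π t - π t₀) - l| ≤ κ →
        deriv Φ s = deriv Φ t) ∧
      (∀ t, |H t - G t| ≤ ε) ∧ ∀ t, |deriv H t - deriv G t| ≤ ε := by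
  obtain ⟨κ, hκ, Φ, hΦ, hΦ0, haff, hΦG, hΦG'⟩ :=
    hF.exists_locally_affine_conj_close hG hα hπ hGα t₀ y₀ hε
  obtain ⟨E, rfl⟩ := hΦ.isUnit
  have hH : IsC1Diffeo ((E : CircleDeg1Lift) * F * (E⁻¹ : CircleDeg1Liftˣ)) :=
    (hΦ.mul hF).mul hΦ.inv
  have hconj : ∀ t, ((E : CircleDeg1Lift) * F * (E⁻¹ : CircleDeg1Liftˣ) : CircleDeg1Lift)
      ((E : CircleDeg1Lift) t) = (E : CircleDeg1Lift) (F t) := fun t => by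
    simp only [mul_apply, units_inv_apply_apply]
  refine ⟨κ, hκ, E, _, hΦ, hH, hΦ0, ?_, hconj, haff, fun t => ?_, fun t => ?_⟩
  · rw [translationNumber_conj_eq, hFα]
  · obtain ⟨s, rfl⟩ := hΦ.surjective t
    rw [hconj]
    exact hΦG s
  · obtain ⟨s, rfl⟩ := hΦ.surjective t
    have h1 := (hH.hasDerivAt ((E : CircleDeg1Lift) s)).comp s (hΦ.hasDerivAt s)
    have h2 := (hΦ.hasDerivAt (F s)).comp s (hF.hasDerivAt s)
    have h3 : ⇑((E : CircleDeg1Lift) * F * (E⁻¹ : CircleDeg1Liftˣ) : CircleDeg1Lift) ∘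
        ⇑(E : CircleDeg1Lift) = ⇑(E : CircleDeg1Lift) ∘ ⇑F := funext hconj
    rw [h3] at h1
    rw [eq_div_of_mul_eq (hΦ.deriv_pos s).ne' (h1.unique h2)]
    exact hΦG' s

end CircleDeg1Lift

/-! ### Arcs of the circle and lifts of circle maps -/

namespace UnitAddCircle

theorem coe_add_int (t : ℝ) (l : ℤ) : ((t + l : ℝ) : UnitAddCircle) = t := by
  have : ((l : ℝ) : UnitAddCircle) = 0 := (AddCircle.coe_eq_zero_iff (1 : ℝ)).2 ⟨l, by simp⟩
  rw [AddCircle.coe_add, this, add_zero]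

theorem exists_eq_add_int {s t : ℝ} (h : (s : UnitAddCircle) = t) : ∃ l : ℤ, s = t + l := by
  have h2 : ((s - t : ℝ) : UnitAddCircle) = 0 := by rw [AddCircle.coe_sub, h, sub_self]
  obtain ⟨l, hl⟩ := (AddCircle.coe_eq_zero_iff (1 : ℝ)).1 h2
  refine ⟨l, ?_⟩
  rw [zsmul_eq_mul, mul_one] at hl
  linarith

theorem coe_mem_cIoo_iff {a b t : ℝ} (hab : a < b) (hba : b < a + 1) :
    (t : UnitAddCircle) ∈ Set.cIoo (a : UnitAddCircle) b ↔ ∃ l : ℤ, a < t + l ∧ t + l < b := by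
  have hp : (0 : ℝ) < 1 := one_pos
  -- In the period starting at `b` the point `a` becomes `a + 1`, so the open arc is the part of
  -- that period above `a + 1`.
  have h1 : toIocMod hp b a = a + 1 :=
    (toIocMod_eq_iff hp).2 ⟨⟨hba, by linarith⟩, -1, by simp⟩
  have h2 : (t : UnitAddCircle) ∈ Set.cIoo (a : UnitAddCircle) b ↔ a + 1 < toIcoMod hp b t := by
    rw [Set.mem_cIoo, sbtw_iff_not_btw]
    change ¬ btw ((b : ℝ) : ℝ ⧸ AddSubgroup.zmultiples (1 : ℝ)) (t : ℝ) (a : ℝ) ↔ _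
    rw [QuotientAddGroup.btw_coe_iff, not_le, h1]
  rw [h2]
  have h3 := toIcoMod_add_toIcoDiv_zsmul hp b t
  obtain ⟨h4, h5⟩ := toIcoMod_mem_Ico hp b t
  constructor
  · intro h
    refine ⟨-toIcoDiv hp b t - 1, ?_, ?_⟩ <;> push_cast <;> rw [zsmul_eq_mul, mul_one] at h3 <;>
      linarith
  · rintro ⟨l, hl1, hl2⟩
    have h6 : toIcoMod hp b t = t + l + 1 := (toIcoMod_eq_iff hp).2
      ⟨⟨by linarith, by linarith⟩, -l - 1, by push_cast [zsmul_eq_mul]; ring⟩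
    rw [h6]; linarith

theorem dist_coe_le (s t : ℝ) : dist (s : UnitAddCircle) t ≤ |s - t| := by
  rw [dist_eq_norm, ← AddCircle.coe_sub, UnitAddCircle.norm_eq]
  simpa using round_le (s - t) 0

end UnitAddCircle

theorem arcLength_coe {a b : ℝ} (hab : a ≤ b) (hba : b < a + 1) :
    arcLength (a : UnitAddCircle) b = b - a := by
  rw [arcLength, ← AddCircle.coe_sub,
    AddCircle.equivIco_coe_eq (p := (1 : ℝ)) (a := 0) ⟨by linarith, by linarith⟩]

theorem IsLift.iterate_coe {F : CircleDeg1Lift} {φ : UnitAddCircle → UnitAddCircle}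
    (h : IsLift F φ) (m : ℕ) (t : ℝ) : φ^[m] (t : UnitAddCircle) = (F^[m] t : ℝ) := by
  induction m with
  | zero => rfl
  | succ m ih => rw [Function.iterate_succ_apply', ih, h, Function.iterate_succ_apply']

theorem IsC1Lift.isC1Diffeo {F : CircleDeg1Lift} {φ : UnitAddCircle → UnitAddCircle}
    (h : IsC1Lift F φ) : F.IsC1Diffeo :=
  ⟨h.contDiff, h.deriv_pos⟩

namespace CircleDeg1Lift

/-- The map of the circle with a given lift. -/
noncomputable def circleMap (F : CircleDeg1Lift) : UnitAddCircle → UnitAddCircle :=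
  Function.Periodic.lift (f := fun t : ℝ => ((F t : ℝ) : UnitAddCircle)) (c := 1) fun t => by
    simp

theorem isLift_circleMap (F : CircleDeg1Lift) : IsLift F F.circleMap := fun _ => rfl

theorem continuous_circleMap {F : CircleDeg1Lift} (hF : Continuous F) : Continuous F.circleMap :=
  ((AddCircle.continuous_mk' (1 : ℝ)).comp hF).quotient_lift _

/-- The homeomorphism of the circle with a given invertible lift. -/
noncomputable def circleHomeomorph (E : CircleDeg1Liftˣ) : UnitAddCircle ≃ₜ UnitAddCircle where
  toFun := (E : CircleDeg1Lift).circleMap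
  invFun := ((E⁻¹ : CircleDeg1Liftˣ) : CircleDeg1Lift).circleMap
  left_inv z := by
    induction z using QuotientAddGroup.induction_on with
    | H t =>
      change ((((E⁻¹ : CircleDeg1Liftˣ) : CircleDeg1Lift) ((E : CircleDeg1Lift) t) : ℝ) :
        UnitAddCircle) = (t : ℝ)
      rw [units_inv_apply_apply]
  right_inv z := by
    induction z using QuotientAddGroup.induction_on with
    | H t =>
      change (((E : CircleDeg1Lift) (((E⁻¹ : CircleDeg1Liftˣ) : CircleDeg1Lift) t) : ℝ) :
        UnitAddCircle) = (t : ℝ)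
      rw [units_apply_inv_apply]
  continuous_toFun := continuous_circleMap (continuous_units E)
  continuous_invFun := continuous_circleMap (continuous_units E⁻¹)

theorem isLift_circleHomeomorph (E : CircleDeg1Liftˣ) : IsLift E (circleHomeomorph E) :=
  isLift_circleMap _

theorem IsC1Diffeo.exists_isC1Lift {F : CircleDeg1Lift} (hF : F.IsC1Diffeo) :
    ∃ f : CircleDiffeo, IsC1Lift F f := by
  obtain ⟨E, rfl⟩ := hF.isUnit
  have h : IsC1Lift E (circleHomeomorph E) :=
    ⟨isLift_circleHomeomorph E, hF.contDiff, hF.deriv_pos⟩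
  exact ⟨⟨circleHomeomorph E, E, h⟩, h⟩

end CircleDeg1Lift

theorem CircleDiffeo.exists_isC1Lift_translationNumber_eq {f : CircleDiffeo} {α : ℝ}
    (h : f.rotationNumber = (α : UnitAddCircle)) :
    ∃ F : CircleDeg1Lift, IsC1Lift F f ∧ F.translationNumber = α := by
  obtain ⟨l, hl⟩ := UnitAddCircle.exists_eq_add_int h
  have hf := f.isC1Lift_lift
  have hd := hf.isC1Diffeo.addConst (-l)
  refine ⟨CircleDeg1Lift.addConst (-l) f.lift, ⟨fun t => ?_, hd.contDiff, hd.deriv_pos⟩, ?_⟩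
  · rw [CircleDeg1Lift.addConst_apply, add_comm, ← Int.cast_neg, UnitAddCircle.coe_add_int,
      hf.isLift]
  · have h2 : Commute ((CircleDeg1Lift.translate (Multiplicative.ofAdd (-l : ℝ)) :
        CircleDeg1Liftˣ) : CircleDeg1Lift) f.lift :=
      CircleDeg1Lift.ext fun t => by
        simp only [CircleDeg1Lift.mul_apply, CircleDeg1Lift.translate_apply]
        rw [add_comm, add_comm (-(l : ℝ)), ← Int.cast_neg, CircleDeg1Lift.map_add_int]
    rw [CircleDeg1Lift.addConst, CircleDeg1Lift.translationNumber_mul_of_commute h2,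
      CircleDeg1Lift.translationNumber_translate, hl]
    ring

/-! ### Order and basic intervals of orbit segments, read off the rotation -/

namespace CircleDeg1Lift

variable {α : ℝ} {F π : CircleDeg1Lift}

/-- Irrationality excludes ties, so a merely monotone `π` determines the order of an orbit. -/
theorem IsRotationSemiconj.iterate_add_lt_iff (h : IsRotationSemiconj α F π) (hα : Irrational α)
    {m m' : ℕ} {l l' : ℤ} {t : ℝ} :
    F^[m] t + l < F^[m'] t + l' ↔ (m : ℝ) * α + l < m' * α + l' := by
  refine ⟨fun hlt => ?_, fun hlt => h.iterate_add_lt hlt t⟩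
  by_contra! hle
  rcases hle.eq_or_lt with heq | hgt
  · obtain ⟨rfl, rfl⟩ := hα.nat_mul_add_int_inj heq
    exact lt_irrefl _ hlt
  · exact lt_asymm hlt (h.iterate_add_lt hgt t)

/-- The neighbour indices depend on `α` and `n` only, which gives the same basic intervals, in terms
of indices, for every diffeomorphism with this rotation number. -/
theorem IsRotationSemiconj.isBasicInterval (h : IsRotationSemiconj α F π) (hα : Irrational α)
    {f : CircleDiffeo} (hf : IsC1Lift F f) (t : ℝ) {n k i j : ℕ} (hk : k ≤ n) (hi : i ≤ n)
    (hj : j ≤ n) {a b : ℤ} (hik : (i : ℝ) * α + a < k * α) (hkj : (k : ℝ) * α < j * α + b)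
    (hji : (j : ℝ) * α + b < i * α + a + 1)
    (honly : ∀ m : ℕ, m ≤ n → ∀ l : ℤ, (i : ℝ) * α + a < m * α + l →
      (m : ℝ) * α + l < j * α + b → m = k ∧ l = 0) :
    F^[i] t + a < F^[k] t ∧ F^[k] t < F^[j] t + b ∧ F^[j] t + b < F^[i] t + a + 1 ∧
      IsBasicInterval f t n (f^[k] t) (f^[i] t) (f^[j] t) := by
  have h1 : F^[i] t + a < F^[k] t := by
    simpa using (h.iterate_add_lt_iff hα (m' := k) (l' := 0) (t := t)).2 (by simpa using hik)
  have h2 : F^[k] t < F^[j] t + b := by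
    simpa using (h.iterate_add_lt_iff hα (m := k) (l := 0) (t := t)).2 (by simpa using hkj)
  have h3 : F^[j] t + b < F^[i] t + a + 1 := by
    have := (h.iterate_add_lt_iff hα (m := j) (l := b) (m' := i) (l' := a + 1) (t := t)).2
      (by push_cast; linarith)
    push_cast at this; linarith
  refine ⟨h1, h2, h3, ⟨i, hi, rfl⟩, ⟨j, hj, rfl⟩, Set.ext fun z => ?_⟩
  have ea : f^[i] (t : UnitAddCircle) = ((F^[i] t + a : ℝ) : UnitAddCircle) := by
    rw [hf.isLift.iterate_coe, UnitAddCircle.coe_add_int]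
  have eb : f^[j] (t : UnitAddCircle) = ((F^[j] t + b : ℝ) : UnitAddCircle) := by
    rw [hf.isLift.iterate_coe, UnitAddCircle.coe_add_int]
  rw [ea, eb]
  constructor
  · rintro ⟨hz, m, hm, rfl⟩
    rw [hf.isLift.iterate_coe, UnitAddCircle.coe_mem_cIoo_iff (h1.trans h2) h3] at hz
    obtain ⟨l, hl1, hl2⟩ := hz
    rw [h.iterate_add_lt_iff hα] at hl1 hl2
    rw [(honly m hm l hl1 hl2).1]
    rfl
  · rintro rfl
    refine ⟨?_, k, hk, rfl⟩
    rw [hf.isLift.iterate_coe, UnitAddCircle.coe_mem_cIoo_iff (h1.trans h2) h3]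
    exact ⟨0, by simpa using h1, by simpa using h2⟩

theorem IsRotationSemiconj.injective_iterate_coe (h : IsRotationSemiconj α F π)
    (hα : Irrational α) {f : CircleDiffeo} (hf : IsC1Lift F f) (t : ℝ) :
    Function.Injective fun m => f^[m] (t : UnitAddCircle) := by
  intro m m' hm
  simp only [hf.isLift.iterate_coe] at hm
  obtain ⟨l, hl⟩ := UnitAddCircle.exists_eq_add_int hm
  have h1 := congrArg π hl
  rw [map_add_int, h.map_iterate, h.map_iterate] at h1
  exact (hα.nat_mul_add_int_inj (m := m) (m' := m') (l := 0) (l' := l)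
    (by push_cast; linarith)).1

end CircleDeg1Lift

/-- Along a sequence depending only on the rotation number, all the orbit segments are adapted. -/
theorem Irrational.exists_forall_isAdapted {α : ℝ} (hα : Irrational α) :
    ∃ κ : ℝ, 0 < κ ∧ ∃ N : ℕ, ∀ n : ℕ, N ≤ n → ∀ c : ℤ, |(n : ℝ) * α - 1 / 2 - c| < κ →
      ∀ f : CircleDiffeo, f.rotationNumber = (α : UnitAddCircle) → ∀ x, IsAdapted f x n := by
  obtain ⟨κ, hκ, N, hN, hadapted⟩ := hα.exists_half_neighbours
  refine ⟨κ, hκ, N, fun n hn c hc f hf x => ?_⟩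
  obtain ⟨F, hF, hFα⟩ := CircleDiffeo.exists_isC1Lift_translationNumber_eq hf
  obtain ⟨π, hπ⟩ := hF.isC1Diffeo.exists_isRotationSemiconj (by rwa [hFα])
  rw [hFα] at hπ
  obtain ⟨i, hi, j, hj, a, b, h1, h2, h3, h4, h5⟩ := hadapted n hn c hc
  induction x using QuotientAddGroup.induction_on with
  | H t =>
    exact ⟨hN.trans hn, (hπ.injective_iterate_coe hα hF t).injOn, i, hi, j, hj,
      (hπ.isBasicInterval hα hF t le_rfl hi hj h1 h2 h3 h4).2.2.2, h5⟩

/-! ### Homeomorphisms matching two similarly ordered families of points -/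

namespace CircleDeg1Lift

/-- An order isomorphism between two sets of reals which is bi-Lipschitz and commutes with the unit
translation extends to a homeomorphism of degree one. -/
theorem exists_units_extension {ι : Type*} [Nonempty ι] {u v : ι → ℝ} {c L C : ℝ} (hc : 0 < c)
    (hc1 : c ≤ 1) (hL1 : 1 ≤ L) (heq : ∀ p q, u p = u q → v p = v q)
    (hlt : ∀ p q, u p < u q → c * (u q - u p) ≤ v q - v p ∧ v q - v p ≤ L * (u q - u p))
    (hC : ∀ p, |v p - u p| ≤ C) (σ : ι ≃ ι) (hu : ∀ p, u (σ p) = u p + 1)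
    (hv : ∀ p, v (σ p) = v p + 1) :
    ∃ E : CircleDeg1Liftˣ, ∀ p, (E : CircleDeg1Lift) (u p) = v p := by
  -- A McShane type extension: `H` is the supremum of broken lines through `(u p, v p)`, of slope
  -- `L` to the left and `c` to the right. Slopes between `c > 0` and `L` make `H` a homeomorphism,
  -- and `c ≤ 1 ≤ L` keeps the supremum finite.
  set θ : ℝ → ℝ := fun d => min (c * d) (L * d) with hθ
  have hθ1 : ∀ d, θ d ≤ d := fun d => by
    rcases le_total 0 d with h | h
    · exact (min_le_left _ _).trans (by nlinarith)
    · exact (min_le_right _ _).trans (by nlinarith)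
  have hcL : c ≤ L := hc1.trans hL1
  have hθc : ∀ d e, d ≤ e → θ d + c * (e - d) ≤ θ e := fun d e hde => by
    refine le_min ?_ ?_
    · have := min_le_left (c * d) (L * d); simp only [hθ]; linarith
    · have := min_le_right (c * d) (L * d); simp only [hθ]; nlinarith
  have hθL : ∀ d e, d ≤ e → θ e ≤ θ d + L * (e - d) := fun d e hde => by
    rw [← sub_le_iff_le_add]
    refine le_min ?_ ?_
    · have := min_le_left (c * e) (L * e); simp only [hθ]; nlinarith
    · have := min_le_right (c * e) (L * e); simp only [hθ]; linarith
  set T : ℝ → ι → ℝ := fun x p => v p + θ (x - u p) with hT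
  have hbdd : ∀ x, BddAbove (Set.range (T x)) := fun x => ⟨x + C, by
    rintro _ ⟨p, rfl⟩
    have h1 := (abs_le.1 (hC p)).2
    have h2 := hθ1 (x - u p)
    simp only [hT]; linarith⟩
  set H : ℝ → ℝ := fun x => ⨆ p, T x p with hH
  have hle : ∀ x p, T x p ≤ H x := fun x p => le_ciSup (hbdd x) p
  have hHc : ∀ x y, x ≤ y → H x + c * (y - x) ≤ H y := fun x y hxy => by
    rw [← le_sub_iff_add_le]
    refine ciSup_le fun p => ?_
    have h1 := hθc (x - u p) (y - u p) (by linarith)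
    rw [sub_sub_sub_cancel_right] at h1
    have h2 := hle y p
    simp only [hT] at h2 ⊢; linarith
  have hHL : ∀ x y, x ≤ y → H y ≤ H x + L * (y - x) := fun x y hxy => by
    refine ciSup_le fun p => ?_
    have h1 := hθL (x - u p) (y - u p) (by linarith)
    rw [sub_sub_sub_cancel_right] at h1
    have h2 := hle x p
    simp only [hT] at h2 ⊢; linarith
  have hmono : StrictMono H := fun x y hxy => by
    have h1 := hHc x y hxy.le
    have h2 := mul_pos hc (sub_pos.2 hxy)
    linarith
  have hcont : Continuous H := by
    refine (LipschitzWith.of_le_add_mul ⟨L, by linarith⟩ fun x y => ?_).continuous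
    change H x ≤ H y + L * dist x y
    rw [Real.dist_eq]
    rcases le_total x y with h | h
    · have h1 := hmono.monotone h
      have h2 : 0 ≤ L * |x - y| := mul_nonneg (by linarith) (abs_nonneg _)
      linarith
    · rw [abs_of_nonneg (by linarith)]; exact hHL y x h
  have hadd : ∀ x, H (x + 1) = H x + 1 := fun x => by
    have h1 : H (x + 1) = ⨆ p, T (x + 1) (σ p) :=
      (σ.iSup_comp (g := T (x + 1))).symm
    have h2 : ∀ p, T (x + 1) (σ p) = T x p + 1 := fun p => by
      simp only [hT, hu, hv, add_sub_add_right_eq_sub]; ring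
    rw [h1]
    simp only [h2]
    exact (ciSup_add (hbdd x) 1).symm
  let K : CircleDeg1Lift := ⟨⟨H, hmono.monotone⟩, hadd⟩
  obtain ⟨E, hE⟩ : IsUnit K := isUnit_iff_bijective.2
    ⟨hmono.injective, surjective_of_continuous (f := K) hcont⟩
  refine ⟨E, fun q => ?_⟩
  rw [hE]
  change H (u q) = v q
  refine le_antisymm (ciSup_le fun p => ?_) ?_
  · rcases lt_trichotomy (u p) (u q) with h | h | h
    · have h1 := (hlt p q h).1
      have h2 := min_le_left (c * (u q - u p)) (L * (u q - u p))
      simp only [hT, hθ]; linarith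
    · simp [hT, hθ, h, heq p q h]
    · have h1 := (hlt q p h).2
      have h2 := min_le_right (c * (u q - u p)) (L * (u q - u p))
      simp only [hT, hθ]; linarith
  · have := hle (u q) q
    simpa [hT, hθ] using this

/-- The distances between distinct points of a finite set modulo `1` are bounded below. -/
theorem exists_pos_le_add_int_sub {ι : Type*} [Finite ι] [Nonempty ι] (w : ι → ℝ) :
    ∃ β > 0, ∀ (p q : ι) (l l' : ℤ), w p + l < w q + l' → β ≤ w q + l' - (w p + l) := by
  -- The smallest positive number congruent modulo `1` to the difference.
  set r : ι × ι → ℝ := fun pq => w pq.2 - w pq.1 - ⌈w pq.2 - w pq.1⌉ + 1 with hr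
  obtain ⟨x, hx⟩ := Finite.exists_min r
  refine ⟨r x, ?_, fun p q l l' h => (hx (p, q)).trans ?_⟩
  · have := Int.ceil_lt_add_one (w x.2 - w x.1)
    simp only [hr]; linarith
  · have h1 : ((l - l' : ℤ) : ℝ) < w q - w p := by push_cast; linarith
    have h2 : l - l' + 1 ≤ ⌈w q - w p⌉ := Int.lt_ceil.2 h1
    have h3 : ((l - l' + 1 : ℤ) : ℝ) ≤ ⌈w q - w p⌉ := by exact_mod_cast h2
    push_cast at h3
    simp only [hr]; linarith

/-- Two finite families of points which are similarly ordered modulo `1` are matched by a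
homeomorphism of degree one. -/
theorem exists_units_matching {ι : Type*} [Finite ι] [Nonempty ι] {w w' : ι → ℝ}
    (h : ∀ (p q : ι) (l l' : ℤ), w p + l < w q + l' ↔ w' p + l < w' q + l') :
    ∃ E : CircleDeg1Liftˣ, ∀ p, (E : CircleDeg1Lift) (w p) = w' p := by
  obtain ⟨β, hβ, hw⟩ := exists_pos_le_add_int_sub w
  obtain ⟨β', hβ', hw'⟩ := exists_pos_le_add_int_sub w'
  obtain ⟨x, hx⟩ := Finite.exists_max fun p => |w' p - w p|
  set C := |w' x - w x| with hC
  have hC0 : 0 ≤ C := abs_nonneg _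
  -- Points move by at most `C`, so gaps change by at most `2C`, which is `M - 1` times the minimal
  -- gap; this gives the Lipschitz constant. `M'` does the same for the inverse.
  set M := 1 + 2 * C / β with hM
  set M' := 1 + 2 * C / β' with hM'
  have hMβ : 2 * C = (M - 1) * β := by rw [hM]; field_simp; ring
  have hMβ' : 2 * C = (M' - 1) * β' := by rw [hM']; field_simp; ring
  have hM1 : 1 ≤ M := by rw [hM]; linarith [div_nonneg (by linarith : 0 ≤ 2 * C) hβ.le]
  have hM1' : 1 ≤ M' := by rw [hM']; linarith [div_nonneg (by linarith : 0 ≤ 2 * C) hβ'.le]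
  suffices hext : ∃ E : CircleDeg1Liftˣ, ∀ p : ι × ℤ,
      (E : CircleDeg1Lift) (w p.1 + p.2) = w' p.1 + p.2 by
    obtain ⟨E, hE⟩ := hext
    exact ⟨E, fun p => by simpa using hE (p, 0)⟩
  refine exists_units_extension (ι := ι × ℤ) (u := fun p => w p.1 + p.2)
    (v := fun p => w' p.1 + p.2) (c := M'⁻¹) (L := M) (C := C) (by positivity)
    (inv_le_one_of_one_le₀ hM1') hM1 ?_ ?_ ?_ ((Equiv.refl ι).prodCongr (Equiv.addRight 1)) ?_ ?_
  · rintro ⟨p, l⟩ ⟨q, l'⟩ he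
    simp only at he ⊢
    refine le_antisymm ?_ ?_
    · by_contra! hlt
      exact absurd ((h _ _ _ _).2 hlt) (by linarith)
    · by_contra! hlt
      exact absurd ((h _ _ _ _).2 hlt) (by linarith)
  · rintro ⟨p, l⟩ ⟨q, l'⟩ hlt
    simp only at hlt ⊢
    have h1 := hw p q l l' hlt
    have h2 := hw' p q l l' ((h _ _ _ _).1 hlt)
    have h3 := abs_le.1 (hx p)
    have h4 := abs_le.1 (hx q)
    constructor
    · rw [inv_mul_le_iff₀ (by linarith)]
      nlinarith
    · nlinarith
  · rintro ⟨p, l⟩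
    simpa using hx p
  · rintro ⟨p, l⟩
    simp; ring
  · rintro ⟨p, l⟩
    simp; ring

end CircleDeg1Lift

/-- Orbit segments of diffeomorphisms with the same irrational rotation number are similarly
ordered. -/
theorem Irrational.similarlyOrdered {α : ℝ} (hα : Irrational α) {f g : CircleDiffeo}
    (hf : f.rotationNumber = (α : UnitAddCircle)) (hg : g.rotationNumber = (α : UnitAddCircle))
    (x y : UnitAddCircle) (n : ℕ) : SimilarlyOrdered f x g y n := by
  obtain ⟨F, hF, hFα⟩ := CircleDiffeo.exists_isC1Lift_translationNumber_eq hf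
  obtain ⟨G, hG, hGα⟩ := CircleDiffeo.exists_isC1Lift_translationNumber_eq hg
  obtain ⟨π, hπ⟩ := hF.isC1Diffeo.exists_isRotationSemiconj (by rwa [hFα])
  obtain ⟨π', hπ'⟩ := hG.isC1Diffeo.exists_isRotationSemiconj (by rwa [hGα])
  rw [hFα] at hπ
  rw [hGα] at hπ'
  induction x using QuotientAddGroup.induction_on with
  | H s =>
  induction y using QuotientAddGroup.induction_on with
  | H t =>
  obtain ⟨E, hE⟩ := CircleDeg1Lift.exists_units_matching (ι := Fin (n + 1))
    (w := fun m => F^[m] s) (w' := fun m => G^[m] t) fun p q l l' => by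
      rw [hπ.iterate_add_lt_iff hα, hπ'.iterate_add_lt_iff hα]
  refine ⟨CircleDeg1Lift.circleHomeomorph E, ⟨E, CircleDeg1Lift.isLift_circleHomeomorph E⟩,
    fun m hm => ?_⟩
  have h1 := hE ⟨m, by omega⟩
  have h2 := hF.isLift.iterate_coe m s
  have h3 := hG.isLift.iterate_coe m t
  calc CircleDeg1Lift.circleHomeomorph E (f^[m] (s : UnitAddCircle))
      = CircleDeg1Lift.circleHomeomorph E ((F^[m] s : ℝ) : UnitAddCircle) := by rw [← h2]
    _ = (((E : CircleDeg1Lift) (F^[m] s) : ℝ) : UnitAddCircle) :=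
        CircleDeg1Lift.isLift_circleHomeomorph E _
    _ = g^[m] (t : UnitAddCircle) := by rw [h3]; exact congrArg _ h1

/-! ### Ratios of orbit segments -/

namespace CircleDeg1Lift

/-- If a conjugacy from `F` to `H` is affine on the basic interval of an orbit segment, then the
ratio of the two halves of this interval is the same for `F` and for `H`. -/
theorem IsRotationSemiconj.exists_isBasicInterval_ratio_eq {α : ℝ} {F H Φ π π' : CircleDeg1Lift}
    (hπ : IsRotationSemiconj α F π) (hπ' : IsRotationSemiconj α H π') (hα : Irrational α)
    (hΦ : Φ.IsC1Diffeo) (hconj : ∀ t, H (Φ t) = Φ (F t)) {f h : CircleDiffeo}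
    (hf : IsC1Lift F f) (hh : IsC1Lift H h) (t : ℝ) {n k i j : ℕ} (hk : k ≤ n) (hi : i ≤ n)
    (hj : j ≤ n) {a b : ℤ} (hik : (i : ℝ) * α + a < k * α) (hkj : (k : ℝ) * α < j * α + b)
    (hji : (j : ℝ) * α + b < i * α + a + 1)
    (honly : ∀ m : ℕ, m ≤ n → ∀ l : ℤ, (i : ℝ) * α + a < m * α + l →
      (m : ℝ) * α + l < j * α + b → m = k ∧ l = 0) {d : ℝ}
    (hd : ∀ s, π t + (i * α + a) ≤ π s → π s ≤ π t + (j * α + b) → deriv Φ s = d) :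
    ∃ ρ : ℝ, (∃ p q, IsBasicInterval f t n (f^[k] t) p q ∧
        ρ = arcLength p (f^[k] t) / arcLength (f^[k] t) q) ∧
      ∃ p q, IsBasicInterval h (Φ t : ℝ) n (h^[k] (Φ t : ℝ)) p q ∧
        ρ = arcLength p (h^[k] (Φ t : ℝ)) / arcLength (h^[k] (Φ t : ℝ)) q := by
  obtain ⟨h1, h2, h3, hb⟩ :=
    hπ.isBasicInterval hα hf t hk hi hj hik hkj hji honly
  obtain ⟨h1', h2', h3', hb'⟩ :=
    hπ'.isBasicInterval hα hh (Φ t) hk hi hj hik hkj hji honly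
  have hiter : ∀ (m : ℕ) (l : ℤ), H^[m] (Φ t) + l = Φ (F^[m] t + l) := fun m l => by
    rw [map_add_int]
    congr 1
    exact ((Function.Semiconj.iterate_right (f := Φ) (ga := F) (gb := H)
      (fun s => (hconj s).symm) m) t).symm
  have hiter0 : H^[k] (Φ t) = Φ (F^[k] t) := by simpa using hiter k 0
  set A := F^[i] t + a with hA
  set B := F^[j] t + b with hB
  set X := F^[k] t with hX
  have hπA : π A = π t + (i * α + a) := by rw [hA, map_add_int, hπ.map_iterate]; ring
  have hπB : π B = π t + (j * α + b) := by rw [hB, map_add_int, hπ.map_iterate]; ring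
  -- Constancy is known on a range of values of `π`; monotonicity transfers it to the whole basic
  -- interval, however long.
  have hd' : ∀ s, A ≤ s → s ≤ B → deriv Φ s = d := fun s hs hs' =>
    hd s (hπA ▸ π.monotone hs) (hπB ▸ π.monotone hs')
  have hd0 : 0 < d := hd' X h1.le h2.le ▸ hΦ.deriv_pos X
  have haff : ∀ s s', A ≤ s → s < s' → s' ≤ B → Φ s' - Φ s = d * (s' - s) := by
    intro s s' hs hss hs'
    obtain ⟨ξ, hξ, hξ'⟩ := exists_hasDerivAt_eq_slope Φ (deriv Φ) hss
      hΦ.continuous.continuousOn fun u _ => hΦ.hasDerivAt u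
    rw [hd' ξ (hs.trans hξ.1.le) (hξ.2.le.trans hs'), eq_div_iff (sub_pos.2 hss).ne'] at hξ'
    exact hξ'.symm
  have arcs : ∀ {G : CircleDeg1Lift} {g : CircleDiffeo} (s : ℝ), IsC1Lift G g →
      G^[i] s + a < G^[k] s → G^[k] s < G^[j] s + b → G^[j] s + b < G^[i] s + a + 1 →
      arcLength (g^[i] s) (g^[k] s) = G^[k] s - (G^[i] s + a) ∧
        arcLength (g^[k] s) (g^[j] s) = G^[j] s + b - G^[k] s := by
    intro G g s hg g1 g2 g3
    rw [hg.isLift.iterate_coe, hg.isLift.iterate_coe, hg.isLift.iterate_coe,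
      ← UnitAddCircle.coe_add_int (G^[i] s) a, ← UnitAddCircle.coe_add_int (G^[j] s) b]
    exact ⟨arcLength_coe g1.le (by linarith), arcLength_coe g2.le (by linarith)⟩
  obtain ⟨e1, e2⟩ := arcs t hf h1 h2 h3
  obtain ⟨e1', e2'⟩ := arcs (Φ t) hh h1' h2' h3'
  refine ⟨_, ⟨_, _, hb, rfl⟩, _, _, hb', ?_⟩
  rw [e1, e2, e1', e2', hiter0, hiter i a, hiter j b, haff A X le_rfl h1 h2.le,
    haff X B h1.le h2 le_rfl, mul_div_mul_left _ _ hd0.ne']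

end CircleDeg1Lift

/-! ### The main theorem -/

theorem mainTheorem2 (α : ℝ) (hα : Irrational α) :
    ∃ k : ℕ → ℕ, StrictMono k ∧
      ∀ f g : CircleDiffeo,
        f.rotationNumber = (α : UnitAddCircle) → g.rotationNumber = (α : UnitAddCircle) →
        ∀ (x y : UnitAddCircle) (ε : ℝ), 0 < ε →
          (∀ i, IsAdapted f x (k i) ∧ IsAdapted g y (k i)) ∧
          ∃ i₀ : ℕ, ∀ i ≥ i₀, ∃ g' : CircleDiffeo,
            CircleDiffeo.C1Close ε g' g ∧
            IsAdapted g' y (k i) ∧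
            SimilarlyOrdered f x g' y (k i) ∧
            SimilarlyOrdered g y g' y (k i) ∧
            (∃ ρ : ℝ, HasInitialRatio f x (k i) ρ ∧ HasInitialRatio g' y (k i) ρ) ∧
            (∃ ρ : ℝ, HasFinalRatio f x (k i) ρ ∧ HasFinalRatio g' y (k i) ρ) := by
  obtain ⟨κ₀, hκ₀, N₀, hadapted⟩ := hα.exists_forall_isAdapted
  obtain ⟨k, hk, hkN⟩ := hα.exists_strictMono_nat_mul_near_half hκ₀ N₀
  have hadapt : ∀ f : CircleDiffeo, f.rotationNumber = (α : UnitAddCircle) →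
      ∀ x i, IsAdapted f x (k i) := fun f hf x i => by
    obtain ⟨hN, c, hc⟩ := hkN i
    exact hadapted (k i) hN c (hc.trans_le (min_le_left _ _)) f hf x
  refine ⟨k, hk, fun f g hf hg x y ε hε =>
    ⟨fun i => ⟨hadapt f hf x i, hadapt g hg y i⟩, ?_⟩⟩
  obtain ⟨F, hF, hFα⟩ := CircleDiffeo.exists_isC1Lift_translationNumber_eq hf
  obtain ⟨G, hG, hGα⟩ := CircleDiffeo.exists_isC1Lift_translationNumber_eq hg
  obtain ⟨π, hπ⟩ := hF.isC1Diffeo.exists_isRotationSemiconj (by rwa [hFα])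
  rw [hFα] at hπ
  induction x using QuotientAddGroup.induction_on with
  | H t₀ =>
  induction y using QuotientAddGroup.induction_on with
  | H y₀ =>
  obtain ⟨κ, hκ, Φ, H, hΦ, hH, hΦ0, hHα, hconj, haff, hHG, hHG'⟩ :=
    hF.isC1Diffeo.exists_conj_close hG.isC1Diffeo hα hπ hFα hGα t₀ y₀ (half_pos hε)
  obtain ⟨g', hg'⟩ := hH.exists_isC1Lift
  obtain ⟨π', hπ'⟩ := hH.exists_isRotationSemiconj (by rwa [hHα])
  rw [hHα] at hπ'
  have hrot : g'.rotationNumber = (α : UnitAddCircle) := by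
    rw [CircleDiffeo.rotationNumber_eq hg', hHα]
  -- `g'` is already fixed; only the threshold `i₀` remains. `N` makes the neighbours `κ / 4`-close,
  -- `M` makes `k i * α` that close to a half turn.
  obtain ⟨N, hN⟩ := hα.exists_rotation_neighbours_lt (show 0 < κ / 4 by positivity)
  obtain ⟨M, hM⟩ := exists_nat_one_div_lt (show 0 < κ / 4 by positivity)
  refine ⟨max N M, fun i hi => ⟨g', ⟨fun z => ?_, fun t => ?_⟩, hadapt g' hrot _ i,
    hα.similarlyOrdered hf hrot _ _ _, hα.similarlyOrdered hg hrot _ _ _, ?_⟩⟩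
  · induction z using QuotientAddGroup.induction_on with
    | H t =>
      have h1 : g' (t : UnitAddCircle) = (H t : ℝ) := hg'.isLift t
      have h2 : g (t : UnitAddCircle) = (G t : ℝ) := hG.isLift t
      calc dist (g' (t : UnitAddCircle)) (g (t : UnitAddCircle))
          ≤ |H t - G t| := by rw [h1, h2]; exact UnitAddCircle.dist_coe_le _ _
        _ < ε := (hHG t).trans_lt (half_lt_self hε)
  · rw [CircleDiffeo.derivAt_eq hg', CircleDiffeo.derivAt_eq hG]
    exact (hHG' t).trans_lt (half_lt_self hε)
  · have hNi : N ≤ k i := ((le_max_left _ _).trans hi).trans (hk.id_le i)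
    obtain ⟨-, c, hc⟩ := hkN i
    have hsmall : |(k i : ℝ) * α - 1 / 2 - c| < κ / 4 := by
      refine (hc.trans_le (min_le_right _ _)).trans (lt_of_le_of_lt ?_ hM)
      have : (M : ℝ) ≤ i := by exact_mod_cast (le_max_right _ _).trans hi
      exact one_div_le_one_div_of_le (by positivity) (by linarith)
    -- After doubling, neighbours within `κ / 4` add `κ / 2` to the error, so the basic interval
    -- stays where `Φ` has constant derivative. The initial point uses `l = 0`, the final one the
    -- odd integer `1 + 2 * c`.
    have key : ∀ (r : ℕ) (l : ℤ), r ≤ k i → |2 * ((r : ℝ) * α) - l| ≤ κ / 2 →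
        ∃ ρ : ℝ, (∃ p q, IsBasicInterval f t₀ (k i) (f^[r] t₀) p q ∧
          ρ = arcLength p (f^[r] t₀) / arcLength (f^[r] t₀) q) ∧
        ∃ p q, IsBasicInterval g' y₀ (k i) (g'^[r] y₀) p q ∧
          ρ = arcLength p (g'^[r] y₀) / arcLength (g'^[r] y₀) q := by
      intro r l hr hl
      obtain ⟨m, hm, m', hm', a, b, h1, h2, h3, h4, h5, h6⟩ := hN (k i) hNi r hr
      have hl' := abs_le.1 hl
      have hnear : ∀ s, π t₀ + (m * α + a) ≤ π s → π s ≤ π t₀ + (m' * α + b) →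
          |2 * (π s - π t₀) - l| ≤ κ := fun s hs hs' => by
        rw [abs_le]; constructor <;> linarith
      have hr1 : π (F^[r] t₀) = π t₀ + r * α := hπ.map_iterate r t₀
      have := hπ.exists_isBasicInterval_ratio_eq hπ' hα hΦ hconj hF hg' t₀ hr hm hm' h1 h2 h3 h4
        (d := deriv Φ (F^[r] t₀)) fun s hs hs' =>
          haff _ _ l (hnear s hs hs') (hnear _ (by linarith) (by linarith))
      rwa [hΦ0] at this
    obtain ⟨ρ₀, ⟨p₀, q₀, h1, h2⟩, p₀', q₀', h3, h4⟩ := key 0 0 (Nat.zero_le _) (by simp; positivity)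
    obtain ⟨ρ, hρ, hρ'⟩ := key (k i) (1 + 2 * c) le_rfl (by
      have h := abs_lt.1 hsmall
      push_cast
      rw [abs_le]
      constructor <;> linarith)
    exact ⟨⟨ρ₀, ⟨p₀, q₀, h1, h2⟩, p₀', q₀', h3, h4⟩, ρ, hρ, hρ'⟩
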